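/- **Setting.** Write elements of $M_n(\mathbb C)\otimes M_n(\mathbb C)$ as $M=(M^i{}_j{}^k{}_l)$ and use the compact matrix notation in which numerical subscripts denote positions in a matrix tensor product; $P$ is the permutation matrix. Let $R\in M_n\otimes M_n$ be invertible and satisfy the quantum Yang–Baxter equation. Let $A$ be a Hopf algebra over $\mathbb C$ with dual quasitriangular structure $\mathcal R:A\otimes A\to\mathbb C$ (convolution invertible, $\mathcal R(ab\otimes c)=\mathcal R(a\otimes c_{(1)})\mathcal R(b\otimes c_{(2)})$, $\mathcal R(a\otimes bc)=\mathcal R(a_{(1)}\otimes c)\mathcal R(a_{(2)}\otimes b)$, $\mathcal R(a_{(1)}\otimes b_{(1)})a_{(2)}b_{(2)}=b_{(1)}a_{(1)}\mathcal R(a_{(2)}\otimes b_{(2)})$), and with a matrix $\mathbf t=(t^i{}_j)$ of elements such that $\Delta\mathbf t=\mathbf t\otimes\mathbf t$, $\epsilon(\mathbf t)=1$ and $\mathcal R(\mathbf t_1\otimes\mathbf t_2)=\lambda R_{12}$ with $\lambda\in\mathbb C\setminus\{0\}$. Let $\tilde A=A\otimes\mathbb C\mathbb Z$, where $\mathbb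 C\mathbb Z=\mathbb C[g,g^{-1}]$ with $g$ group-like, with the tensor product dual quasitriangular structure, where $\mathcal R(g^a\otimes g^b)=\lambda^{-ab}$. Let $R'\in M_n\otimes M_n$ be invertible with (i) $R_{12}R_{13}R'_{23}=R'_{23}R_{13}R_{12}$ and $R_{23}R_{13}R'_{12}=R'_{12}R_{13}R_{23}$; (ii) $(PR+1)(PR'-1)=0$; and suppose that $R'_{12}\mathbf t_1\mathbf t_2=\mathbf t_2\mathbf t_1R'_{12}$ in $A$. Let $V^*(R')$ be the algebra with generators $x_1,\dots,x_n$ and relations $\mathbf x_1\mathbf x_2=\mathbf x_2\mathbf x_1R'_{12}$, i.e. $x_jx_l=\sum_{i,k}x_kx_iR'^i{}_j{}^k{}_l$. **Statement.** (a) There is a right coaction of $\tilde A$ on $V^*(R')$ which is an algebra homomorphism with $\mathbf x\mapsto\mathbf x\mathbf tg$. Put $\Psi(v\otimes w)=w^{\bar{(1)}}\otimes v^{\bar{(1)}}\mathcal R(v^{\bar{(2)}}\otimes w^{\bar{(2)}})$, where $v\mapsto v^{\bar{(1)}}\otimes v^{\bar{(2)}}$ is this coaction. Then $\Psi(\mathbf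 x_1\otimes\mathbf x_2)=\mathbf x_2\otimes\mathbf x_1R_{12}$. There is a linear braided coproduct $\underline\Delta:V^*(R')\to V^*(R')\otimes V^*(R')$, i.e. $\underline\Delta x_i=x_i\otimes1+1\otimes x_i$, $\underline\Delta1=1\otimes1$, and $\underline\Delta$ is multiplicative for the product $(a\otimes b)(c\otimes d)=a\Psi(b\otimes c)d$. (b) Let $V^*(R')\rtimes\tilde A$ be the algebra generated by $\tilde A$ and a copy of $V^*(R')$ with generators $p_i$, with cross relations $p_i\,a=\sum_j a_{(1)}p_j\,\mathcal R(t^j{}_ig\otimes a_{(2)})$ for $a\in\tilde A$. Multiplication $a\otimes v\mapsto av$ is a linear isomorphism $\tilde A\otimes V^*(R')\to V^*(R')\rtimes\tilde A$; the cross relations include $\mathbf pg=\lambda^{-1}g\mathbf p$ and $\mathbf p_1\mathbf t_2=\lambda\mathbf t_2\mathbf p_1R_{12}$; and $V^*(R')\rtimes\tilde A$ is a Hopf algebra containing $\tilde A$ as a sub-Hopf algebra, with $\Delta\mathbf p=\mathbf p\otimes\mathbf tg+1\otimes\mathbf p$ and $\epsilon(\mathbf p)=0$. (c) There is a right coaction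 $\beta:V^*(R')\to V^*(R')\otimes(V^*(R')\rtimes\tilde A)$ which is an algebra homomorphism and is given on the generators by $\mathbf x'=\mathbf x\mathbf tg+\mathbf p$, i.e. $\beta(x_i)=\sum_a x_a\otimes t^a{}_ig+1\otimes p_i$. (d) $\underline\Delta$ is covariant: it intertwines the coaction of $\tilde A$ on $V^*(R')$ with its tensor square, and it intertwines $\beta$ with the tensor product coaction of $V^*(R')\rtimes\tilde A$ on $V^*(R')\otimes V^*(R')$ in which the first factor carries the coaction of $\tilde A\subset V^*(R')\rtimes\tilde A$ and the second factor carries $\beta$. In particular (a)–(d) hold for $q$-Minkowski space: for every $R$ as above with $(PR+1)(PR-q^{-2})(PR-q^2)=0$, $q\neq0$, and every $\mu$ for which $R'=P+\mu P(PR-q^{-2})(PR-q^2)$ is invertible. In this case (i), (ii) and $R'_{12}\mathbf t_1\mathbf t_2=\mathbf t_2\mathbf t_1R'_{12}$ need not be assumed. -/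

import Mathlib

open scoped TensorProduct Matrix LaurentPolynomial

noncomputable section

namespace QPoincare

/-! ### Matrix data

A matrix `M ∈ Mₙ ⊗ Mₙ` is stored with `M (i, k) (j, l) = M^i_j^k_l`. -/

/-- Elements of `Mₙ(ℂ) ⊗ Mₙ(ℂ)`. -/
abbrev Mat₂ (n : ℕ) := Matrix (Fin n × Fin n) (Fin n × Fin n) ℂ

/-- Elements of `Mₙ(ℂ) ⊗ Mₙ(ℂ) ⊗ Mₙ(ℂ)`. -/
abbrev Mat₃ (n : ℕ) := Matrix (Fin n × Fin n × Fin n) (Fin n × Fin n × Fin n) ℂ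

/-- The permutation matrix `P^i_j^k_l = δ^i_l δ^k_j`. -/
def perm (n : ℕ) : Mat₂ n := fun a b => if a.1 = b.2 ∧ a.2 = b.1 then 1 else 0

/-- `M` placed in the tensor factors 1 and 2. -/
def leg12 {n : ℕ} (M : Mat₂ n) : Mat₃ n :=
  fun a b => M (a.1, a.2.1) (b.1, b.2.1) * if a.2.2 = b.2.2 then 1 else 0

/-- `M` placed in the tensor factors 1 and 3. -/
def leg13 {n : ℕ} (M : Mat₂ n) : Mat₃ n :=
  fun a b => M (a.1, a.2.2) (b.1, b.2.2) * if a.2.1 = b.2.1 then 1 else 0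

/-- `M` placed in the tensor factors 2 and 3. -/
def leg23 {n : ℕ} (M : Mat₂ n) : Mat₃ n :=
  fun a b => M (a.2.1, a.2.2) (b.2.1, b.2.2) * if a.1 = b.1 then 1 else 0

/-- The quantum Yang-Baxter equation `R₁₂ R₁₃ R₂₃ = R₂₃ R₁₃ R₁₂`. -/
def IsQYBE {n : ℕ} (R : Mat₂ n) : Prop :=
  leg12 R * leg13 R * leg23 R = leg23 R * leg13 R * leg12 R

/-- The pair of conditions on `(R, R')` under which `V*(R')` is a braided bialgebra with the
braiding given by `R`: `R₁₂ R₁₃ R'₂₃ = R'₂₃ R₁₃ R₁₂`, `R₂₃ R₁₃ R'₁₂ = R'₁₂ R₁₃ R₂₃`, and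
`(P R + 1) (P R' - 1) = 0`. -/
structure IsBraidedCovectorData {n : ℕ} (R R' : Mat₂ n) : Prop where
  mixed_left : leg12 R * leg13 R * leg23 R' = leg23 R' * leg13 R * leg12 R
  mixed_right : leg23 R * leg13 R * leg12 R' = leg12 R' * leg13 R * leg23 R
  hecke : (perm n * R + 1) * (perm n * R' - 1) = 0

/-- The matrix `R' = P + μ P (P R - q⁻²) (P R - q²)` defining `q`-Minkowski space. -/
def minkowskiR' {n : ℕ} (R : Mat₂ n) (q μ : ℂ) : Mat₂ n :=
  perm n + μ • (perm n * (perm n * R - (q ^ 2)⁻¹ • 1) * (perm n * R - q ^ 2 • 1))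

/-! ### The braided covectors `V*(R')` as an algebra -/

/-- The relations `x_j x_l = ∑ x_k x_i R'^i_j^k_l`, i.e. `𝐱₁ 𝐱₂ = 𝐱₂ 𝐱₁ R'₁₂`. -/
inductive CovectorRel {n : ℕ} (R' : Mat₂ n) :
    FreeAlgebra ℂ (Fin n) → FreeAlgebra ℂ (Fin n) → Prop
  | mk (j l : Fin n) : CovectorRel R'
      (FreeAlgebra.ι ℂ j * FreeAlgebra.ι ℂ l)
      (∑ i, ∑ k, R' (i, k) (j, l) • (FreeAlgebra.ι ℂ k * FreeAlgebra.ι ℂ i))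

/-- The algebra `V*(R')`. -/
abbrev Covector {n : ℕ} (R' : Mat₂ n) := RingQuot (CovectorRel R')

/-- The generators `x_i` of `V*(R')`. -/
def gen {n : ℕ} (R' : Mat₂ n) (i : Fin n) : Covector R' :=
  RingQuot.mkAlgHom ℂ (CovectorRel R') (FreeAlgebra.ι ℂ i)

/-! ### The quantum group `A` and its extension `Ã = A ⊗ ℂℤ` -/

section QuantumGroup

variable {A : Type*} [Ring A] [HopfAlgebra ℂ A] {n : ℕ}

/-- `t` is a matrix of elements with `Δ t^i_j = ∑ t^i_a ⊗ t^a_j` and `ε(t^i_j) = δ^i_j`. -/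
structure IsMatrixCoalgebra (t : Matrix (Fin n) (Fin n) A) : Prop where
  comul : ∀ i j, Coalgebra.comul (R := ℂ) (t i j) = ∑ a, t i a ⊗ₜ[ℂ] t a j
  counit : ∀ i j, Coalgebra.counit (R := ℂ) (t i j) = if i = j then 1 else 0

/-- `M₁₂ 𝐭₁ 𝐭₂ = 𝐭₂ 𝐭₁ M₁₂`, i.e. `M^i_a^k_b t^a_j t^b_l = t^k_b t^i_a M^a_j^b_l`. -/
def MatrixCommutes (M : Mat₂ n) (t : Matrix (Fin n) (Fin n) A) : Prop :=
  ∀ i j k l, ∑ a, ∑ b, M (i, k) (a, b) • (t a j * t b l) =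
    ∑ a, ∑ b, M (a, b) (j, l) • (t k b * t i a)

/-- `𝓡 : A ⊗ A → ℂ` is a dual quasitriangular structure: it is convolution invertible,
`𝓡(ab ⊗ c) = 𝓡(a ⊗ c₍₁₎) 𝓡(b ⊗ c₍₂₎)`, `𝓡(a ⊗ bc) = 𝓡(a₍₁₎ ⊗ c) 𝓡(a₍₂₎ ⊗ b)` and
`𝓡(a₍₁₎ ⊗ b₍₁₎) a₍₂₎ b₍₂₎ = b₍₁₎ a₍₁₎ 𝓡(a₍₂₎ ⊗ b₍₂₎)`. -/
structure IsDualQuasitriangular (𝓡 : A →ₗ[ℂ] A →ₗ[ℂ] ℂ) : Prop where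
  convolution_invertible : ∃ 𝓡' : A ⊗[ℂ] A →ₗ[ℂ] ℂ,
    LinearMap.mul' ℂ ℂ ∘ₗ TensorProduct.map (TensorProduct.lift 𝓡) 𝓡' ∘ₗ Coalgebra.comul
      = Coalgebra.counit ∧
    LinearMap.mul' ℂ ℂ ∘ₗ TensorProduct.map 𝓡' (TensorProduct.lift 𝓡) ∘ₗ Coalgebra.comul
      = Coalgebra.counit
  mul_left : ∀ a b c, 𝓡 (a * b) c =
    LinearMap.mul' ℂ ℂ (TensorProduct.map (𝓡 a) (𝓡 b) (Coalgebra.comul c))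
  mul_right : ∀ a b c, 𝓡 a (b * c) =
    LinearMap.mul' ℂ ℂ (TensorProduct.map (𝓡.flip c) (𝓡.flip b) (Coalgebra.comul a))
  quasicommutative :
    (TensorProduct.lid ℂ A).toLinearMap ∘ₗ
        TensorProduct.map (TensorProduct.lift 𝓡) (LinearMap.mul' ℂ A) ∘ₗ Coalgebra.comul =
      (TensorProduct.rid ℂ A).toLinearMap ∘ₗ
        TensorProduct.map (LinearMap.mul' ℂ A ∘ₗ (TensorProduct.comm ℂ A A).toLinearMap)
          (TensorProduct.lift 𝓡) ∘ₗ Coalgebra.comul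

variable (A) in
/-- The extended Hopf algebra `Ã = A ⊗ ℂℤ`, where `ℂℤ = ℂ[g, g⁻¹]` with `g` group-like. -/
abbrev Ext := A ⊗[ℂ] ℂ[T;T⁻¹]

/-- The form `𝓡(gᵃ ⊗ gᵇ) = λ^(-ab)` on `ℂℤ`. -/
def dilatonForm (lam : ℂ) : LinearMap.BilinForm ℂ ℂ[T;T⁻¹] :=
  (Finsupp.lsum ℂ fun a : ℤ => LinearMap.toSpanSingleton ℂ _
    ((Finsupp.lsum ℂ fun b : ℤ => LinearMap.toSpanSingleton ℂ ℂ (lam ^ (-(a * b)))) ∘ₗ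
      (AddMonoidAlgebra.coeffLinearEquiv ℂ).toLinearMap)) ∘ₗ
    (AddMonoidAlgebra.coeffLinearEquiv ℂ).toLinearMap

/-- The tensor product dual quasitriangular structure on `Ã`. -/
def extForm (𝓡 : A →ₗ[ℂ] A →ₗ[ℂ] ℂ) (lam : ℂ) : Ext A →ₗ[ℂ] Ext A →ₗ[ℂ] ℂ :=
  LinearMap.BilinForm.tmul 𝓡 (dilatonForm lam)

/-- The element `g` of `Ã`. -/
def dil : Ext A := 1 ⊗ₜ[ℂ] LaurentPolynomial.T 1

/-- An element of `A` viewed in `Ã`. -/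
def toExt (a : A) : Ext A := a ⊗ₜ[ℂ] 1

/-! ### Coactions, braiding and braided coproduct -/

section Coactions

variable {V W H : Type*} [AddCommGroup V] [Module ℂ V] [AddCommGroup W] [Module ℂ W]
  [Ring H] [Algebra ℂ H]

/-- `ρ : V → V ⊗ H` is a right coaction of the coalgebra `(H, Δ, ε)`. -/
structure IsRightCoaction (Δ : H →ₗ[ℂ] H ⊗[ℂ] H) (ε : H →ₗ[ℂ] ℂ) (ρ : V →ₗ[ℂ] V ⊗[ℂ] H) :
    Prop where
  coassoc : (TensorProduct.assoc ℂ V H H).toLinearMap ∘ₗ ρ.rTensor H ∘ₗ ρ = Δ.lTensor V ∘ₗ ρ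
  counit : (TensorProduct.rid ℂ V).toLinearMap ∘ₗ ε.lTensor V ∘ₗ ρ = LinearMap.id

/-- The tensor product coaction `v ⊗ w ↦ v⁽¹⁾ ⊗ w⁽¹⁾ ⊗ v⁽²⁾ w⁽²⁾`. -/
def tensorCoaction (ρ : V →ₗ[ℂ] V ⊗[ℂ] H) (σ : W →ₗ[ℂ] W ⊗[ℂ] H) :
    V ⊗[ℂ] W →ₗ[ℂ] (V ⊗[ℂ] W) ⊗[ℂ] H :=
  (LinearMap.mul' ℂ H).lTensor (V ⊗[ℂ] W) ∘ₗ
    (TensorProduct.tensorTensorTensorComm ℂ V H W H).toLinearMap ∘ₗ TensorProduct.map ρ σ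

/-- The braiding `Ψ(v ⊗ w) = w⁽¹⁾ ⊗ v⁽¹⁾ 𝓡(v⁽²⁾ ⊗ w⁽²⁾)` on a comodule `V`. -/
def braiding (r : H →ₗ[ℂ] H →ₗ[ℂ] ℂ) (ρ : V →ₗ[ℂ] V ⊗[ℂ] H) : V ⊗[ℂ] V →ₗ[ℂ] V ⊗[ℂ] V :=
  (TensorProduct.rid ℂ (V ⊗[ℂ] V)).toLinearMap ∘ₗ
    TensorProduct.map (TensorProduct.comm ℂ V V).toLinearMap (TensorProduct.lift r) ∘ₗ
    (TensorProduct.tensorTensorTensorComm ℂ V H V H).toLinearMap ∘ₗ TensorProduct.map ρ ρ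

/-- The braided tensor product multiplication `(a ⊗ b) (c ⊗ d) = a Ψ(b ⊗ c) d`. -/
def braidedMul {B : Type*} [Ring B] [Algebra ℂ B] (Ψ : B ⊗[ℂ] B →ₗ[ℂ] B ⊗[ℂ] B) :
    (B ⊗[ℂ] B) ⊗[ℂ] (B ⊗[ℂ] B) →ₗ[ℂ] B ⊗[ℂ] B :=
  TensorProduct.map (LinearMap.mul' ℂ B) (LinearMap.mul' ℂ B) ∘ₗ
    (TensorProduct.tensorTensorTensorAssoc ℂ B B B B).symm.toLinearMap ∘ₗ
    (Ψ.lTensor B).rTensor B ∘ₗ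
    (TensorProduct.tensorTensorTensorAssoc ℂ B B B B).toLinearMap

end Coactions

/-- `D : V*(R') → V*(R') ⊗ V*(R')` is the linear braided coproduct for the braiding `Ψ`:
`D x_i = x_i ⊗ 1 + 1 ⊗ x_i`, and `D` is an algebra homomorphism to the braided tensor product. -/
structure IsLinearBraidedCoproduct {R' : Mat₂ n}
    (Ψ : Covector R' ⊗[ℂ] Covector R' →ₗ[ℂ] Covector R' ⊗[ℂ] Covector R')
    (D : Covector R' →ₗ[ℂ] Covector R' ⊗[ℂ] Covector R') : Prop where
  map_gen : ∀ i, D (gen R' i) = gen R' i ⊗ₜ 1 + 1 ⊗ₜ gen R' i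
  map_one : D 1 = 1 ⊗ₜ 1
  map_mul : ∀ v w, D (v * w) = braidedMul Ψ (D v ⊗ₜ D w)

/-! ### The semidirect product `V*(R') ⋊ Ã` -/

/-- The element `a₍₁₎ 𝓡(t^j_i g ⊗ a₍₂₎)` of `Ã`. The right action of `Ã` on the generators `p_i`
is `p_i ◁ a = ∑ p_j 𝓡(t^j_i g ⊗ a)`, so `a₍₁₎ (p_i ◁ a₍₂₎)` is the sum over `j` of the product of
this element and `p_j`. -/
def crossCoeff (𝓡 : A →ₗ[ℂ] A →ₗ[ℂ] ℂ) (lam : ℂ) (t : Matrix (Fin n) (Fin n) A) (j i : Fin n) :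
    Ext A →ₗ[ℂ] Ext A :=
  (TensorProduct.rid ℂ (Ext A)).toLinearMap ∘ₗ
    (extForm 𝓡 lam (toExt (t j i) * dil)).lTensor (Ext A) ∘ₗ Coalgebra.comul

/-- The relations of `V*(R') ⋊ Ã`: those of `Ã`, those of `V*(R')` for the generators `p_i`, and
the cross relations `p_i a = a₍₁₎ (p_i ◁ a₍₂₎)` for `a ∈ Ã`. -/
inductive PoincareRel (R' : Mat₂ n) (𝓡 : A →ₗ[ℂ] A →ₗ[ℂ] ℂ) (lam : ℂ)
    (t : Matrix (Fin n) (Fin n) A) :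
    FreeAlgebra ℂ (Fin n ⊕ Ext A) → FreeAlgebra ℂ (Fin n ⊕ Ext A) → Prop
  | add (a b : Ext A) : PoincareRel R' 𝓡 lam t (FreeAlgebra.ι ℂ (Sum.inr (a + b)))
      (FreeAlgebra.ι ℂ (Sum.inr a) + FreeAlgebra.ι ℂ (Sum.inr b))
  | smul (c : ℂ) (a : Ext A) : PoincareRel R' 𝓡 lam t (FreeAlgebra.ι ℂ (Sum.inr (c • a)))
      (c • FreeAlgebra.ι ℂ (Sum.inr a))
  | one : PoincareRel R' 𝓡 lam t (FreeAlgebra.ι ℂ (Sum.inr 1)) 1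
  | mul (a b : Ext A) : PoincareRel R' 𝓡 lam t (FreeAlgebra.ι ℂ (Sum.inr (a * b)))
      (FreeAlgebra.ι ℂ (Sum.inr a) * FreeAlgebra.ι ℂ (Sum.inr b))
  | momentum (j l : Fin n) : PoincareRel R' 𝓡 lam t
      (FreeAlgebra.ι ℂ (Sum.inl j) * FreeAlgebra.ι ℂ (Sum.inl l))
      (∑ i, ∑ k, R' (i, k) (j, l) •
        (FreeAlgebra.ι ℂ (Sum.inl k) * FreeAlgebra.ι ℂ (Sum.inl i)))
  | cross (i : Fin n) (a : Ext A) : PoincareRel R' 𝓡 lam t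
      (FreeAlgebra.ι ℂ (Sum.inl i) * FreeAlgebra.ι ℂ (Sum.inr a))
      (∑ j, FreeAlgebra.ι ℂ (Sum.inr (crossCoeff 𝓡 lam t j i a)) * FreeAlgebra.ι ℂ (Sum.inl j))

/-- The algebra `V*(R') ⋊ Ã`. -/
abbrev Poincare (R' : Mat₂ n) (𝓡 : A →ₗ[ℂ] A →ₗ[ℂ] ℂ) (lam : ℂ)
    (t : Matrix (Fin n) (Fin n) A) :=
  RingQuot (PoincareRel R' 𝓡 lam t)

section Inclusions

variable (R' : Mat₂ n) (𝓡 : A →ₗ[ℂ] A →ₗ[ℂ] ℂ) (lam : ℂ) (t : Matrix (Fin n) (Fin n) A)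

/-- The algebra map `V*(R') → V*(R') ⋊ Ã`, sending `x_i` to the generator `p_i`. -/
def momentum : Covector R' →ₐ[ℂ] Poincare R' 𝓡 lam t :=
  RingQuot.liftAlgHom ℂ ⟨FreeAlgebra.lift ℂ fun i =>
    RingQuot.mkAlgHom ℂ (PoincareRel R' 𝓡 lam t) (FreeAlgebra.ι ℂ (Sum.inl i)), by
      rintro _ _ ⟨j, l⟩
      have h := RingQuot.mkAlgHom_rel ℂ (PoincareRel.momentum (R' := R') (𝓡 := 𝓡) (lam := lam)
        (t := t) j l)
      simpa only [map_mul, map_sum, map_smul, FreeAlgebra.lift_ι_apply] using h⟩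

/-- The algebra map `Ã → V*(R') ⋊ Ã`. -/
def rotation : Ext A →ₐ[ℂ] Poincare R' 𝓡 lam t :=
  AlgHom.ofLinearMap
    { toFun := fun a => RingQuot.mkAlgHom ℂ (PoincareRel R' 𝓡 lam t) (FreeAlgebra.ι ℂ (Sum.inr a))
      map_add' := fun a b => by
        rw [RingQuot.mkAlgHom_rel ℂ (PoincareRel.add a b), map_add]
      map_smul' := fun c a => by
        rw [RingQuot.mkAlgHom_rel ℂ (PoincareRel.smul c a), map_smul, RingHom.id_apply] }
    (by
      show RingQuot.mkAlgHom ℂ (PoincareRel R' 𝓡 lam t) (FreeAlgebra.ι ℂ (Sum.inr 1)) = 1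
      rw [RingQuot.mkAlgHom_rel ℂ PoincareRel.one, map_one])
    (fun a b => by
      show RingQuot.mkAlgHom ℂ (PoincareRel R' 𝓡 lam t) (FreeAlgebra.ι ℂ (Sum.inr (a * b))) =
        RingQuot.mkAlgHom ℂ (PoincareRel R' 𝓡 lam t) (FreeAlgebra.ι ℂ (Sum.inr a)) *
        RingQuot.mkAlgHom ℂ (PoincareRel R' 𝓡 lam t) (FreeAlgebra.ι ℂ (Sum.inr b))
      rw [RingQuot.mkAlgHom_rel ℂ (PoincareRel.mul a b), map_mul])

/-- The product `a ⊗ v ↦ a v` from `Ã ⊗ V*(R')` to `V*(R') ⋊ Ã`. -/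
def normalOrder : Ext A ⊗[ℂ] Covector R' →ₗ[ℂ] Poincare R' 𝓡 lam t :=
  LinearMap.mul' ℂ _ ∘ₗ
    TensorProduct.map (rotation R' 𝓡 lam t).toLinearMap (momentum R' 𝓡 lam t).toLinearMap

end Inclusions

/-- `(Δ, ε, S)` makes the algebra `H` a Hopf algebra. -/
structure IsHopf {H : Type*} [Ring H] [Algebra ℂ H] (Δ : H →ₐ[ℂ] H ⊗[ℂ] H) (ε : H →ₐ[ℂ] ℂ)
    (S : H →ₗ[ℂ] H) : Prop where
  coassoc : (TensorProduct.assoc ℂ H H H).toLinearMap ∘ₗ Δ.toLinearMap.rTensor H ∘ₗ Δ.toLinearMap =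
    Δ.toLinearMap.lTensor H ∘ₗ Δ.toLinearMap
  counit_left : (TensorProduct.lid ℂ H).toLinearMap ∘ₗ ε.toLinearMap.rTensor H ∘ₗ Δ.toLinearMap =
    LinearMap.id
  counit_right : (TensorProduct.rid ℂ H).toLinearMap ∘ₗ ε.toLinearMap.lTensor H ∘ₗ Δ.toLinearMap =
    LinearMap.id
  antipode_left : LinearMap.mul' ℂ H ∘ₗ S.rTensor H ∘ₗ Δ.toLinearMap =
    Algebra.linearMap ℂ H ∘ₗ ε.toLinearMap
  antipode_right : LinearMap.mul' ℂ H ∘ₗ S.lTensor H ∘ₗ Δ.toLinearMap =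
    Algebra.linearMap ℂ H ∘ₗ ε.toLinearMap

/-- `(Δ, ε, S)` is the Hopf algebra structure of the semidirect product `V*(R') ⋊ Ã`:
the underlying space is `V*(R') ⊗ Ã`, the explicit cross relations are
`𝐩 g = λ⁻¹ g 𝐩` and `𝐩₁ 𝐭₂ = λ 𝐭₂ 𝐩₁ R₁₂`, the coproduct is `Δ 𝐩 = 𝐩 ⊗ 𝐭 g + 1 ⊗ 𝐩`, and
`Ã` is a sub-Hopf algebra. -/
structure IsSemidirectHopf (R R' : Mat₂ n) (𝓡 : A →ₗ[ℂ] A →ₗ[ℂ] ℂ) (lam : ℂ)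
    (t : Matrix (Fin n) (Fin n) A)
    (Δ : Poincare R' 𝓡 lam t →ₐ[ℂ] Poincare R' 𝓡 lam t ⊗[ℂ] Poincare R' 𝓡 lam t)
    (ε : Poincare R' 𝓡 lam t →ₐ[ℂ] ℂ)
    (S : Poincare R' 𝓡 lam t →ₗ[ℂ] Poincare R' 𝓡 lam t) : Prop where
  bijective : Function.Bijective (normalOrder R' 𝓡 lam t)
  cross_dil : ∀ i, momentum R' 𝓡 lam t (gen R' i) * rotation R' 𝓡 lam t dil =
    lam⁻¹ • (rotation R' 𝓡 lam t dil * momentum R' 𝓡 lam t (gen R' i))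
  cross_matrix : ∀ i k l,
    momentum R' 𝓡 lam t (gen R' i) * rotation R' 𝓡 lam t (toExt (t k l)) =
      ∑ a, ∑ b, (lam * R (a, b) (i, l)) •
        (rotation R' 𝓡 lam t (toExt (t k b)) * momentum R' 𝓡 lam t (gen R' a))
  hopf : IsHopf Δ ε S
  comul_momentum : ∀ i, Δ (momentum R' 𝓡 lam t (gen R' i)) =
    ∑ a, momentum R' 𝓡 lam t (gen R' a) ⊗ₜ rotation R' 𝓡 lam t (toExt (t a i) * dil) +
      1 ⊗ₜ momentum R' 𝓡 lam t (gen R' i)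
  comul_rotation : ∀ a, Δ (rotation R' 𝓡 lam t a) =
    TensorProduct.map (rotation R' 𝓡 lam t).toLinearMap (rotation R' 𝓡 lam t).toLinearMap
      (Coalgebra.comul a)
  counit_momentum : ∀ i, ε (momentum R' 𝓡 lam t (gen R' i)) = 0
  counit_rotation : ∀ a, ε (rotation R' 𝓡 lam t a) = Coalgebra.counit (R := ℂ) a
  antipode_rotation : ∀ a, S (rotation R' 𝓡 lam t a) =
    rotation R' 𝓡 lam t (HopfAlgebra.antipode ℂ a)

/-- The coaction of `Ã` on `V*(R')`: an algebra homomorphism with `𝐱 ↦ 𝐱 𝐭 g` that is a right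
coaction. -/
structure IsRotationCoaction (R' : Mat₂ n) (t : Matrix (Fin n) (Fin n) A)
    (ρ : Covector R' →ₐ[ℂ] Covector R' ⊗[ℂ] Ext A) : Prop where
  map_gen : ∀ i, ρ (gen R' i) = ∑ a, gen R' a ⊗ₜ (toExt (t a i) * dil)
  coaction : IsRightCoaction Coalgebra.comul Coalgebra.counit ρ.toLinearMap

/-- Poincaré covariance of `V*(R')`. Here `ρ` is the rotation and dilation coaction of `Ã` on `V*(R')`, `D` the linear
braided coproduct of `V*(R')`, `(Δ, ε, S)` the Hopf algebra structure of `V*(R') ⋊ Ã`, and `β`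
the coaction of `V*(R') ⋊ Ã` on `V*(R')`. Covariance of `D` under `V*(R') ⋊ Ã` means that `D`
is a comodule map from `V*(R')` with the coaction `β` to the tensor product of two comodules
`V*(R')`: the first one, the vectors to be translated, is only rotated (through `Ã ⊂ V*(R') ⋊ Ã`)
and the second one carries `β`. -/
def PoincareCovariance (R R' : Mat₂ n) (𝓡 : A →ₗ[ℂ] A →ₗ[ℂ] ℂ) (lam : ℂ)
    (t : Matrix (Fin n) (Fin n) A) : Prop :=
  ∃ (ρ : Covector R' →ₐ[ℂ] Covector R' ⊗[ℂ] Ext A)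
    (D : Covector R' →ₗ[ℂ] Covector R' ⊗[ℂ] Covector R')
    (Δ : Poincare R' 𝓡 lam t →ₐ[ℂ] Poincare R' 𝓡 lam t ⊗[ℂ] Poincare R' 𝓡 lam t)
    (ε : Poincare R' 𝓡 lam t →ₐ[ℂ] ℂ)
    (S : Poincare R' 𝓡 lam t →ₗ[ℂ] Poincare R' 𝓡 lam t)
    (β : Covector R' →ₐ[ℂ] Covector R' ⊗[ℂ] Poincare R' 𝓡 lam t),
    IsRotationCoaction R' t ρ ∧
    -- the braiding is `Ψ(𝐱₁ ⊗ 𝐱₂) = 𝐱₂ ⊗ 𝐱₁ R₁₂`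
    (∀ j l, braiding (extForm 𝓡 lam) ρ.toLinearMap (gen R' j ⊗ₜ gen R' l) =
      ∑ i, ∑ k, R (i, k) (j, l) • (gen R' k ⊗ₜ[ℂ] gen R' i)) ∧
    IsLinearBraidedCoproduct (braiding (extForm 𝓡 lam) ρ.toLinearMap) D ∧
    IsSemidirectHopf R R' 𝓡 lam t Δ ε S ∧
    -- `β` is the algebra homomorphism `𝐱' = 𝐱 𝐭 g + 𝐩`
    (∀ i, β (gen R' i) =
      ∑ a, gen R' a ⊗ₜ rotation R' 𝓡 lam t (toExt (t a i) * dil) +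
        1 ⊗ₜ momentum R' 𝓡 lam t (gen R' i)) ∧
    -- `β` is a right coaction of `V*(R') ⋊ Ã`
    IsRightCoaction Δ.toLinearMap ε.toLinearMap β.toLinearMap ∧
    -- the braided coproduct is covariant under `Ã` ...
    D.rTensor (Ext A) ∘ₗ ρ.toLinearMap = tensorCoaction ρ.toLinearMap ρ.toLinearMap ∘ₗ D ∧
    -- ... and under `V*(R') ⋊ Ã`
    D.rTensor (Poincare R' 𝓡 lam t) ∘ₗ β.toLinearMap =
      tensorCoaction
        ((rotation R' 𝓡 lam t).toLinearMap.lTensor (Covector R') ∘ₗ ρ.toLinearMap)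
        β.toLinearMap ∘ₗ D

end QuantumGroup

end QPoincare

end

/-! The factor `g` normalises the form: `𝓡(𝐭₁ g ⊗ 𝐭₂ g)` is exactly `R`. Contracting against `𝐭 g`
gives a matrix of endomorphisms `a ↦ a₍₁₎ 𝓡(t^j_i g ⊗ a₍₂₎)` of `Ã`, multiplicative because `𝓡` is;
this matrix is the cross relation. All homomorphisms then come from universal properties, and
identities between them are checked on generators.

Elements `y_i` satisfy the relations of `V*(R')` exactly when the row `N` of products `y_j y_l`
satisfies `N · PR' = N`. Rotation by `𝐭 g` preserves this because `PR'` commutes with `𝐭₁ 𝐭₂`. For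
`𝐲 𝐭 g + 𝐩` the cross terms combine into a row times `PR + 1`, which is fixed because `(PR + 1)(PR'
- 1) = 0` (`IsCovector.rotate_add`). With `𝐲 = 𝐩` this yields the coproduct, with `𝐲 = 𝐱` the
coaction `β`. The antipode is the antimultiplicative map with `S(𝐩) = -𝐩 S(𝐭 g)`; its row of
products is `N · PR` times `S(𝐭₁ 𝐭₂ g²)`, fixed for the same reason. That `Δ` and `S` respect the
cross relations is quasicommutativity (`sum_rotMat_mul_leftContract`). The semidirect product acts
on `Ã ⊗ V*(R')`, and acting on `1 ⊗ 1` inverts normal ordering (`normalOrder_bijective`).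

No braided tensor product algebra has to be built. The map `a ⊗ b ↦ a⁽¹⁾ ⊗ a⁽²⁾ b` embeds `V* ⊗ V*`
in the ordinary algebra `V* ⊗ (V* ⋊ Ã)`, carries the braided product to the ordinary one
(`braidedEmbedding_braidedMul`) and sends `x_i ⊗ 1 + 1 ⊗ x_i` to `β(x_i)`. Hence `β` factors through
it, and the factor is the braided coproduct. Its covariance is coassociativity of `β`, seen through
the embedding (`poincare_covariant`); setting `𝐩 = 0` leaves covariance under `Ã`.

For `q`-Minkowski space `PR'` is a polynomial in `PR`, and `PR` commutes with `𝐭₁ 𝐭₂` by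
quasicommutativity; the cubic relation gives `(PR + 1)(PR' - 1) = 0`. -/

noncomputable section

namespace QPoincare

/-! ### Contraction of a coalgebra against a functional -/

section Contraction

variable {C : Type*} [AddCommGroup C] [Module ℂ C] [Coalgebra ℂ C]

open Coalgebra

/-- The endomorphism `a ↦ a₍₁₎ f(a₍₂₎)` of a coalgebra. -/
def rightContract (f : C →ₗ[ℂ] ℂ) : C →ₗ[ℂ] C :=
  (TensorProduct.rid ℂ C).toLinearMap ∘ₗ f.lTensor C ∘ₗ comul

/-- The endomorphism `a ↦ f(a₍₁₎) a₍₂₎` of a coalgebra. -/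
def leftContract (f : C →ₗ[ℂ] ℂ) : C →ₗ[ℂ] C :=
  (TensorProduct.lid ℂ C).toLinearMap ∘ₗ f.rTensor C ∘ₗ comul

/-- Coassociativity: the functional only sees the last leg, so both sides are `a₍₁₎ ⊗ a₍₂₎ f(a₍₃₎)`.
-/
lemma comul_rightContract (f : C →ₗ[ℂ] ℂ) (a : C) :
    comul (R := ℂ) (rightContract f a) = (rightContract f).lTensor C (comul a) := by
  have h : ∀ X : C ⊗[ℂ] C, comul (R := ℂ) (TensorProduct.rid ℂ C (f.lTensor C X)) =
      TensorProduct.rid ℂ (C ⊗[ℂ] C) (f.lTensor (C ⊗[ℂ] C) (comul.rTensor C X)) := by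
    intro X
    induction X with
    | zero => simp
    | add x y hx hy => simp only [map_add, hx, hy]
    | tmul x y => simp
  have h2 : ∀ X : C ⊗[ℂ] (C ⊗[ℂ] C), TensorProduct.rid ℂ (C ⊗[ℂ] C) (f.lTensor (C ⊗[ℂ] C)
      ((TensorProduct.assoc ℂ C C C).symm X)) =
      ((TensorProduct.rid ℂ C).toLinearMap ∘ₗ f.lTensor C).lTensor C X := by
    intro X
    induction X with
    | zero => simp
    | add x y hx hy => simp only [map_add, hx, hy]
    | tmul x y =>
      induction y with
      | zero => simp
      | add y z hy hz => simp only [map_add, TensorProduct.tmul_add, hy, hz]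
      | tmul y z => simp
  rw [rightContract, LinearMap.comp_apply, LinearMap.comp_apply, LinearEquiv.coe_coe, h,
    ← coassoc_symm_apply, h2, ← LinearMap.comp_apply, ← LinearMap.lTensor_comp]
  rfl

/-- Both sides evaluate `f` on the middle leg of `a₍₁₎ ⊗ a₍₂₎ ⊗ a₍₃₎`. This is the bridge from cross
coefficients to quasicommutativity, which compares left and right contractions. -/
lemma rTensor_rightContract_comul (f : C →ₗ[ℂ] ℂ) (a : C) :
    (rightContract f).rTensor C (comul a) = (leftContract f).lTensor C (comul a) := by
  have h : ∀ X : (C ⊗[ℂ] C) ⊗[ℂ] C,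
      ((TensorProduct.rid ℂ C).toLinearMap ∘ₗ f.lTensor C).rTensor C X =
      ((TensorProduct.lid ℂ C).toLinearMap ∘ₗ f.rTensor C).lTensor C
        (TensorProduct.assoc ℂ C C C X) := by
    intro X
    induction X with
    | zero => simp
    | add x y hx hy => simp only [map_add, hx, hy]
    | tmul x y =>
      induction x with
      | zero => simp
      | add y z hy hz => simp only [map_add, TensorProduct.add_tmul, hy, hz]
      | tmul y z => simp [TensorProduct.smul_tmul]
  rw [rightContract, leftContract, ← LinearMap.comp_assoc, ← LinearMap.comp_assoc,
    LinearMap.rTensor_comp, LinearMap.lTensor_comp, LinearMap.comp_apply, LinearMap.comp_apply, h,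
    coassoc_apply]

lemma counit_rightContract (f : C →ₗ[ℂ] ℂ) (a : C) :
    counit (R := ℂ) (rightContract f a) = f a := by
  have h : ∀ X : C ⊗[ℂ] C, counit (R := ℂ) (TensorProduct.rid ℂ C (f.lTensor C X)) =
      f (TensorProduct.lid ℂ C (counit.rTensor C X)) := by
    intro X
    induction X with
    | zero => simp
    | add x y hx hy => simp only [map_add, hx, hy]
    | tmul x y => simp [mul_comm]
  rw [rightContract, LinearMap.comp_apply, LinearMap.comp_apply, LinearEquiv.coe_coe, h,
    rTensor_counit_comul]
  simp

lemma rightContract_counit : rightContract (counit : C →ₗ[ℂ] ℂ) = LinearMap.id := by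
  ext a
  simp [rightContract]

lemma apply_rightContract (f g : C →ₗ[ℂ] ℂ) (a : C) :
    f (rightContract g a) = LinearMap.mul' ℂ ℂ (TensorProduct.map f g (comul a)) := by
  rw [rightContract, LinearMap.comp_apply, LinearMap.comp_apply]
  generalize (comul a : C ⊗[ℂ] C) = X
  induction X with
  | zero => simp
  | add x y hx hy => simp only [map_add, hx, hy]
  | tmul x y => simp [mul_comm]

/-- Functionals act on the coalgebra by contraction as a representation of the convolution algebra.
-/
lemma rightContract_rightContract (f g : C →ₗ[ℂ] ℂ) (a : C) :
    rightContract f (rightContract g a) =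
      rightContract (LinearMap.mul' ℂ ℂ ∘ₗ TensorProduct.map f g ∘ₗ comul) a := by
  have : f ∘ₗ rightContract g = LinearMap.mul' ℂ ℂ ∘ₗ TensorProduct.map f g ∘ₗ comul := by
    ext a
    exact apply_rightContract f g a
  rw [← this]
  conv_lhs => rw [rightContract, LinearMap.comp_apply, LinearMap.comp_apply, comul_rightContract,
    ← LinearMap.comp_apply (LinearMap.lTensor C f), ← LinearMap.lTensor_comp]
  rfl

end Contraction

/-! ### Dual quasitriangular forms: unitality, tensor products, quasicommutativity -/

section Coquasitriangular

open Coalgebra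

/-- The parts of a dual quasitriangular structure that do not mention the convolution inverse,
together with unitality. -/
structure IsCoquasitriangular {H : Type*} [Ring H] [Bialgebra ℂ H] (r : H →ₗ[ℂ] H →ₗ[ℂ] ℂ) :
    Prop where
  mul_left : ∀ a b c, r (a * b) c =
    LinearMap.mul' ℂ ℂ (TensorProduct.map (r a) (r b) (comul c))
  mul_right : ∀ a b c, r a (b * c) =
    LinearMap.mul' ℂ ℂ (TensorProduct.map (r.flip c) (r.flip b) (comul a))
  one_left : ∀ c, r 1 c = counit (R := ℂ) c
  one_right : ∀ a, r a 1 = counit (R := ℂ) a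

/-- An idempotent functional with a right convolution inverse is the counit. -/
lemma eq_counit_of_convolution {C : Type*} [AddCommGroup C] [Module ℂ C] [Coalgebra ℂ C]
    (f g : C →ₗ[ℂ] ℂ)
    (hf : ∀ c, LinearMap.mul' ℂ ℂ (TensorProduct.map f f (comul c)) = f c)
    (hg : ∀ c, LinearMap.mul' ℂ ℂ (TensorProduct.map f g (comul c)) = counit (R := ℂ) c) (c : C) :
    f c = counit (R := ℂ) c := by
  have h1 : f ∘ₗ rightContract g = counit :=
    LinearMap.ext fun c => (apply_rightContract f g c).trans (hg c)
  -- With `⋆` for convolution: `ε = f ⋆ g = (f ⋆ f) ⋆ g = f ⋆ (f ⋆ g) = f ⋆ ε = f`.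
  rw [← hg c, ← apply_rightContract, ← hf (rightContract g c), ← apply_rightContract,
    rightContract_rightContract]
  have h2 : LinearMap.mul' ℂ ℂ ∘ₗ TensorProduct.map f g ∘ₗ comul = counit := LinearMap.ext hg
  rw [h2, rightContract_counit]
  rfl

/-- Since `1 · 1 = 1`, multiplicativity makes `𝓡(1 ⊗ -)` and `𝓡(- ⊗ 1)` convolution idempotents.
They are invertible, by restricting the inverse of `𝓡`, so they equal the counit. -/
lemma IsDualQuasitriangular.isCoquasitriangular {A : Type*} [Ring A] [HopfAlgebra ℂ A]
    {𝓡 : A →ₗ[ℂ] A →ₗ[ℂ] ℂ} (h : IsDualQuasitriangular 𝓡) : IsCoquasitriangular 𝓡 := by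
  obtain ⟨𝓡', h1, -⟩ := h.convolution_invertible
  refine ⟨h.mul_left, h.mul_right, ?_, ?_⟩
  · refine eq_counit_of_convolution (𝓡 1) (𝓡' ∘ₗ TensorProduct.mk ℂ A A 1) ?_ ?_
    · intro c
      rw [← h.mul_left, one_mul]
    · intro c
      have := LinearMap.congr_fun h1 (1 ⊗ₜ c)
      simp only [LinearMap.comp_apply, TensorProduct.comul_tmul, TensorProduct.counit_tmul,
        Bialgebra.comul_one, Bialgebra.counit_one, smul_eq_mul, mul_one] at this
      rw [← this]
      generalize (comul c : A ⊗[ℂ] A) = X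
      induction X with
      | zero => simp
      | add x y hx hy => simp only [map_add, TensorProduct.tmul_add, hx, hy]
      | tmul x y => simp [Algebra.TensorProduct.one_def]
  · refine eq_counit_of_convolution (𝓡.flip 1) (𝓡' ∘ₗ (TensorProduct.mk ℂ A A).flip 1) ?_ ?_
    · intro c
      rw [← h.mul_right, one_mul]
      rfl
    · intro c
      have := LinearMap.congr_fun h1 (c ⊗ₜ 1)
      simp only [LinearMap.comp_apply, TensorProduct.comul_tmul, TensorProduct.counit_tmul,
        Bialgebra.comul_one, Bialgebra.counit_one, one_smul] at this
      rw [← this]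
      generalize (comul c : A ⊗[ℂ] A) = X
      induction X with
      | zero => simp
      | add x y hx hy => simp only [map_add, TensorProduct.add_tmul, hx, hy]
      | tmul x y => simp [Algebra.TensorProduct.one_def]

variable {H K : Type*} [Ring H] [HopfAlgebra ℂ H] [Ring K] [HopfAlgebra ℂ K]

lemma IsCoquasitriangular.tmul {r : LinearMap.BilinForm ℂ H} {s : LinearMap.BilinForm ℂ K}
    (hr : IsCoquasitriangular r) (hs : IsCoquasitriangular s) :
    IsCoquasitriangular (H := H ⊗[ℂ] K) (LinearMap.BilinForm.tmul r s) := by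
  refine ⟨?_, ?_, ?_, ?_⟩
  · intro a b c
    induction a with
    | zero => simp
    | add x y hx hy => simp only [map_add, add_mul, LinearMap.add_apply, hx, hy,
        TensorProduct.map_add_left]
    | tmul a a' =>
    induction b with
    | zero => simp
    | add x y hx hy => simp only [map_add, mul_add, LinearMap.add_apply, hx, hy,
        TensorProduct.map_add_right]
    | tmul b b' =>
    induction c with
    | zero => simp
    | add x y hx hy => simp only [map_add, hx, hy]
    | tmul c c' =>
    simp only [Algebra.TensorProduct.tmul_mul_tmul, LinearMap.BilinForm.tensorDistrib_tmul,
      hr.mul_left, hs.mul_left, TensorProduct.comul_tmul]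
    generalize (comul c : H ⊗[ℂ] H) = X
    generalize (comul c' : K ⊗[ℂ] K) = Y
    induction X with
    | zero => simp
    | add x y hx hy => simp only [map_add, TensorProduct.add_tmul, smul_add, hx, hy]
    | tmul c d =>
    induction Y with
    | zero => simp
    | add x y hx hy => simp only [map_add, TensorProduct.tmul_add, add_smul, hx, hy]
    | tmul c' d' => simp [mul_mul_mul_comm]
  · intro a b c
    induction a with
    | zero => simp
    | add x y hx hy => simp only [map_add, LinearMap.add_apply, hx, hy]
    | tmul a a' =>
    induction b with
    | zero => simp
    | add x y hx hy => simp only [map_add, add_mul, hx, hy, TensorProduct.map_add_right,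
        LinearMap.add_apply]
    | tmul b b' =>
    induction c with
    | zero => simp
    | add x y hx hy => simp only [map_add, mul_add, hx, hy, TensorProduct.map_add_left,
        LinearMap.add_apply]
    | tmul c c' =>
    simp only [Algebra.TensorProduct.tmul_mul_tmul, LinearMap.BilinForm.tensorDistrib_tmul,
      hr.mul_right, hs.mul_right, TensorProduct.comul_tmul]
    generalize (comul a : H ⊗[ℂ] H) = X
    generalize (comul a' : K ⊗[ℂ] K) = Y
    induction X with
    | zero => simp
    | add x y hx hy => simp only [map_add, TensorProduct.add_tmul, smul_add, hx, hy]
    | tmul x y =>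
    induction Y with
    | zero => simp
    | add x y hx hy => simp only [map_add, TensorProduct.tmul_add, add_smul, hx, hy]
    | tmul x' y' => simp [mul_mul_mul_comm]
  · intro c
    induction c with
    | zero => simp
    | add x y hx hy => simp only [map_add, hx, hy]
    | tmul c c' =>
      rw [Algebra.TensorProduct.one_def]
      simp [hr.one_left, hs.one_left]
  · intro c
    induction c with
    | zero => simp
    | add x y hx hy => simp only [map_add, LinearMap.add_apply, hx, hy]
    | tmul c c' =>
      rw [Algebra.TensorProduct.one_def]
      simp [hr.one_right, hs.one_right]

lemma rightContract_tmul (f : H →ₗ[ℂ] ℂ) (g : K →ₗ[ℂ] ℂ) (F : H ⊗[ℂ] K →ₗ[ℂ] ℂ)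
    (hF : ∀ x y, F (x ⊗ₜ y) = f x * g y) (x : H) (y : K) :
    rightContract F (x ⊗ₜ y) = rightContract f x ⊗ₜ rightContract g y := by
  simp only [rightContract, LinearMap.comp_apply, TensorProduct.comul_tmul]
  generalize (comul x : H ⊗[ℂ] H) = X
  generalize (comul y : K ⊗[ℂ] K) = Y
  induction X with
  | zero => simp
  | add x y hx hy => simp only [map_add, TensorProduct.add_tmul, hx, hy]
  | tmul a b =>
  induction Y with
  | zero => simp
  | add x y hx hy => simp only [map_add, TensorProduct.tmul_add, hx, hy]
  | tmul c d => simp [hF, TensorProduct.smul_tmul', TensorProduct.tmul_smul, smul_smul, mul_comm]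

lemma leftContract_tmul (f : H →ₗ[ℂ] ℂ) (g : K →ₗ[ℂ] ℂ) (F : H ⊗[ℂ] K →ₗ[ℂ] ℂ)
    (hF : ∀ x y, F (x ⊗ₜ y) = f x * g y) (x : H) (y : K) :
    leftContract F (x ⊗ₜ y) = leftContract f x ⊗ₜ leftContract g y := by
  simp only [leftContract, LinearMap.comp_apply, TensorProduct.comul_tmul]
  generalize (comul x : H ⊗[ℂ] H) = X
  generalize (comul y : K ⊗[ℂ] K) = Y
  induction X with
  | zero => simp
  | add x y hx hy => simp only [map_add, TensorProduct.add_tmul, hx, hy]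
  | tmul a b =>
  induction Y with
  | zero => simp
  | add x y hx hy => simp only [map_add, TensorProduct.tmul_add, hx, hy]
  | tmul c d => simp [hF, TensorProduct.smul_tmul', TensorProduct.tmul_smul, smul_smul, mul_comm]

/-- Quasicommutativity at `t^k_i ⊗ b`, with the coproduct of `𝐭` expanded. Every use of
quasicommutativity passes through this form. -/
lemma IsDualQuasitriangular.sum_mul_leftContract {n : ℕ} {𝓡 : H →ₗ[ℂ] H →ₗ[ℂ] ℂ}
    (h : IsDualQuasitriangular 𝓡) {t : Matrix (Fin n) (Fin n) H} (ht : IsMatrixCoalgebra t)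
    (k i : Fin n) (b : H) :
    ∑ j, t j i * leftContract (𝓡 (t k j)) b = ∑ j, rightContract (𝓡 (t j i)) b * t k j := by
  have := LinearMap.congr_fun h.quasicommutative (t k i ⊗ₜ b)
  simp only [LinearMap.comp_apply, TensorProduct.comul_tmul, ht.comul, TensorProduct.sum_tmul,
    map_sum] at this
  simp only [leftContract, rightContract, LinearMap.comp_apply]
  generalize (comul b : H ⊗[ℂ] H) = X at this ⊢
  convert this using 2 with j _ j _
  · clear this
    induction X with
    | zero => simp
    | add x y hx hy => simp only [map_add, TensorProduct.tmul_add, mul_add, hx, hy]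
    | tmul x y => simp
  · clear this
    induction X with
    | zero => simp
    | add x y hx hy => simp only [map_add, TensorProduct.tmul_add, add_mul, hx, hy]
    | tmul x y => simp

end Coquasitriangular

/-! ### The form on `ℂ[g, g⁻¹]` -/

section Dilaton

open Coalgebra LaurentPolynomial

lemma comul_T (m : ℤ) : comul (R := ℂ) (T m : ℂ[T;T⁻¹]) = T m ⊗ₜ T m := by
  simp

lemma counit_T (m : ℤ) : counit (R := ℂ) (T m : ℂ[T;T⁻¹]) = 1 := by
  simp

lemma dilatonForm_T (lam : ℂ) (a b : ℤ) : dilatonForm lam (T a) (T b) = lam ^ (-(a * b)) := by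
  simp [dilatonForm, T, -single_eq_C_mul_T]

@[elab_as_elim]
lemma laurent_induction {p : ℂ[T;T⁻¹] → Prop} (x : ℂ[T;T⁻¹]) (hT : ∀ m, p (T m))
    (hadd : ∀ x y, p x → p y → p (x + y)) (hsmul : ∀ (c : ℂ) x, p x → p (c • x)) : p x := by
  induction x using LaurentPolynomial.induction_on' with
  | add x y hx hy => exact hadd x y hx hy
  | C_mul_T n a =>
    rw [← LaurentPolynomial.smul_eq_C_mul]
    exact hsmul _ _ (hT n)

/-- Powers of `g` are group-like, so on them the axioms say only that the exponent `-ab` is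
biadditive. -/
lemma isCoquasitriangular_dilatonForm {lam : ℂ} (hlam : lam ≠ 0) :
    IsCoquasitriangular (dilatonForm lam) := by
  refine ⟨?_, ?_, ?_, ?_⟩
  · intro a b c
    induction a using laurent_induction with
    | hadd x y hx hy => simp only [map_add, add_mul, LinearMap.add_apply, hx, hy,
        TensorProduct.map_add_left]
    | hsmul k x hx => simp only [smul_mul_assoc, map_smul, LinearMap.smul_apply, hx,
        TensorProduct.map_smul_left]
    | hT a =>
    induction b using laurent_induction with
    | hadd x y hx hy => simp only [map_add, mul_add, LinearMap.add_apply, hx, hy,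
        TensorProduct.map_add_right]
    | hsmul k x hx => simp only [mul_smul_comm, map_smul, LinearMap.smul_apply, hx,
        TensorProduct.map_smul_right]
    | hT b =>
    induction c using laurent_induction with
    | hadd x y hx hy => simp only [map_add, hx, hy]
    | hsmul k x hx => simp only [map_smul, hx]
    | hT c =>
      rw [← T_add, comul_T]
      simp only [TensorProduct.map_tmul, LinearMap.mul'_apply, dilatonForm_T]
      rw [← zpow_add₀ hlam]
      congr 1
      ring
  · intro a b c
    induction a using laurent_induction with
    | hadd x y hx hy => simp only [map_add, LinearMap.add_apply, hx, hy]
    | hsmul k x hx => simp only [map_smul, LinearMap.smul_apply, hx]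
    | hT a =>
    induction b using laurent_induction with
    | hadd x y hx hy => simp only [map_add, add_mul, hx, hy,
        TensorProduct.map_add_right, LinearMap.add_apply]
    | hsmul k x hx => simp only [smul_mul_assoc, map_smul, LinearMap.smul_apply, hx,
        TensorProduct.map_smul_right]
    | hT b =>
    induction c using laurent_induction with
    | hadd x y hx hy => simp only [map_add, mul_add, hx, hy,
        TensorProduct.map_add_left, LinearMap.add_apply]
    | hsmul k x hx => simp only [mul_smul_comm, map_smul, LinearMap.smul_apply, hx,
        TensorProduct.map_smul_left]
    | hT c =>
      rw [← T_add, comul_T]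
      simp only [TensorProduct.map_tmul, LinearMap.mul'_apply, dilatonForm_T, LinearMap.flip_apply]
      rw [← zpow_add₀ hlam]
      congr 1
      ring
  · intro c
    induction c using laurent_induction with
    | hadd x y hx hy => simp only [map_add, hx, hy]
    | hsmul k x hx => simp only [map_smul, hx]
    | hT c => rw [← T_zero, dilatonForm_T, counit_T]; simp
  · intro c
    induction c using laurent_induction with
    | hadd x y hx hy => simp only [map_add, LinearMap.add_apply, hx, hy]
    | hsmul k x hx => simp only [map_smul, LinearMap.smul_apply, hx]
    | hT c => rw [← T_zero, dilatonForm_T, counit_T]; simp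

lemma IsDualQuasitriangular.extForm {A : Type*} [Ring A] [HopfAlgebra ℂ A]
    {𝓡 : A →ₗ[ℂ] A →ₗ[ℂ] ℂ} (h : IsDualQuasitriangular 𝓡) {lam : ℂ} (hlam : lam ≠ 0) :
    IsCoquasitriangular (extForm 𝓡 lam) :=
  h.isCoquasitriangular.tmul (isCoquasitriangular_dilatonForm hlam)

end Dilaton

end QPoincare

end

noncomputable section

namespace QPoincare

/-! ### Rows of vectors times scalar matrices -/

section Rows

variable {I : Type*} [Fintype I] {E F G : Type*} [AddCommMonoid E] [Module ℂ E] [AddCommMonoid F]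
  [Module ℂ F] [AddCommMonoid G] [Module ℂ G]

/-- The product of a row of vectors with a scalar matrix. -/
def rowMul (N : I → E) (M : Matrix I I ℂ) : I → E := fun x => ∑ y, M y x • N y

lemma rowMul_mul (N : I → E) (M M' : Matrix I I ℂ) :
    rowMul N (M * M') = rowMul (rowMul N M) M' := by
  ext x
  simp only [rowMul, Matrix.mul_apply, Finset.sum_smul, Finset.smul_sum]
  rw [Finset.sum_comm]
  simp only [smul_smul, mul_comm]

lemma rowMul_one [DecidableEq I] (N : I → E) : rowMul N 1 = N := by
  ext x
  simp [rowMul, Matrix.one_apply]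

lemma rowMul_add (N : I → E) (M M' : Matrix I I ℂ) :
    rowMul N (M + M') = rowMul N M + rowMul N M' := by
  ext x
  simp [rowMul, add_smul, Finset.sum_add_distrib]

lemma add_rowMul (N N' : I → E) (M : Matrix I I ℂ) :
    rowMul (N + N') M = rowMul N M + rowMul N' M := by
  ext x
  simp [rowMul, Finset.sum_add_distrib]

lemma map_rowMul (f : E →ₗ[ℂ] F) (N : I → E) (M : Matrix I I ℂ) (x : I) :
    f (rowMul N M x) = rowMul (fun y => f (N y)) M x := by
  simp [rowMul]

/-- Associativity of matrix products: `(N U) M = N (M U) = (N M) U` when `M` and `U` commute. The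
pairing `φ` is arbitrary because it serves both for tensor products and for products in an opposite
algebra. -/
lemma rowMul_sum_bilin (φ : E →ₗ[ℂ] F →ₗ[ℂ] G) (N : I → E) (U : I → I → F) (M : Matrix I I ℂ)
    (hU : ∀ x z, ∑ y, M x y • U y z = ∑ y, M y z • U x y) :
    rowMul (fun w => ∑ x, φ (N x) (U x w)) M = fun w => ∑ x, φ (rowMul N M x) (U x w) := by
  ext w
  simp only [rowMul, Finset.smul_sum, map_sum, LinearMap.sum_apply, map_smul, LinearMap.smul_apply]
  rw [Finset.sum_comm]
  simp only [← map_smul, ← map_sum]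
  simp only [← hU]
  simp only [map_sum, map_smul]
  rw [Finset.sum_comm]

end Rows

/-! ### The covector relations as a fixed-row condition -/

section MatrixAlgebra

variable {n : ℕ}

lemma perm_mul_apply (M : Mat₂ n) (i k : Fin n) (x : Fin n × Fin n) :
    (perm n * M) (i, k) x = M (k, i) x := by
  rw [Matrix.mul_apply, Finset.sum_eq_single (k, i)]
  · simp [perm]
  · rintro ⟨a, b⟩ - h
    have : ¬ (i = b ∧ k = a) := fun h' => h (by rw [h'.1, h'.2])
    simp [perm, this]
  · simp

lemma perm_mul_perm (n : ℕ) : perm n * perm n = 1 := by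
  ext ⟨i, k⟩ ⟨j, l⟩
  rw [perm_mul_apply]
  simp [perm, Matrix.one_apply, and_comm]

variable {B : Type*} [Semiring B] [Algebra ℂ B]

/-- The entries of `𝐭₁ 𝐭₂`. -/
def tensorSq (t : Matrix (Fin n) (Fin n) B) (x y : Fin n × Fin n) : B := t x.1 y.1 * t x.2 y.2

/-- The permutation absorbs the transposed order in `𝐱₂ 𝐱₁ M₁₂`, so the relations and the cross
terms both become right multiplication of a row by `P M`. -/
lemma sum_eq_rowMul (M : Mat₂ n) (N : Fin n × Fin n → B) (j l : Fin n) :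
    ∑ i, ∑ k, M (i, k) (j, l) • N (k, i) = rowMul N (perm n * M) (j, l) := by
  rw [rowMul, Fintype.sum_prod_type, Finset.sum_comm]
  simp only [perm_mul_apply]

/-- The elements `y_i` satisfy the relations of the braided covectors. -/
def IsCovector (R' : Mat₂ n) (y : Fin n → B) : Prop :=
  rowMul (fun x : Fin n × Fin n => y x.1 * y x.2) (perm n * R') = fun x => y x.1 * y x.2

lemma isCovector_iff (R' : Mat₂ n) (y : Fin n → B) : IsCovector R' y ↔
    ∀ j l, y j * y l = ∑ i, ∑ k, R' (i, k) (j, l) • (y k * y i) := by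
  rw [IsCovector, funext_iff, Prod.forall]
  refine forall_congr' fun j => forall_congr' fun l => ?_
  rw [sum_eq_rowMul R' (fun x => y x.1 * y x.2), eq_comm]

/-- `M` commutes with `𝐭₁ 𝐭₂`. -/
def CommutesTensorSq (M : Mat₂ n) (t : Matrix (Fin n) (Fin n) B) : Prop :=
  ∀ x z, ∑ y, M x y • tensorSq t y z = ∑ y, M y z • tensorSq t x y

/-- Multiplying by `P` on the left turns `𝐭₂ 𝐭₁` into `𝐭₁ 𝐭₂`, so the exchange relation becomes an
honest commutation. -/
lemma matrixCommutes_iff {A : Type*} [Ring A] [HopfAlgebra ℂ A] (M : Mat₂ n)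
    (t : Matrix (Fin n) (Fin n) A) : MatrixCommutes M t ↔ CommutesTensorSq (perm n * M) t := by
  constructor
  · rintro h ⟨i, k⟩ ⟨j, l⟩
    have := h k j i l
    rw [Finset.sum_comm (f := fun a b => M (a, b) (j, l) • (t i b * t k a))] at this
    simpa only [Fintype.sum_prod_type, perm_mul_apply, tensorSq] using this
  · intro h i j k l
    have := h (k, i) (j, l)
    simp only [Fintype.sum_prod_type, perm_mul_apply, tensorSq] at this
    rw [Finset.sum_comm (f := fun a b => M (a, b) (j, l) • (t k b * t i a))]
    exact this

lemma CommutesTensorSq.map {M : Mat₂ n} {t : Matrix (Fin n) (Fin n) B} (h : CommutesTensorSq M t)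
    {C : Type*} [Semiring C] [Algebra ℂ C] (f : B →ₐ[ℂ] C) :
    CommutesTensorSq M (fun i j => f (t i j)) := by
  intro x z
  have := congrArg f (h x z)
  simpa only [map_sum, map_smul, tensorSq, map_mul] using this

variable {C : Type*} [Semiring C] [Algebra ℂ C]

lemma rotated_mul (y : Fin n → B) (t : Matrix (Fin n) (Fin n) C) (w : Fin n × Fin n) :
    (∑ a, y a ⊗ₜ[ℂ] t a w.1) * (∑ a, y a ⊗ₜ[ℂ] t a w.2) =
      ∑ x : Fin n × Fin n, (y x.1 * y x.2) ⊗ₜ[ℂ] tensorSq t x w := by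
  simp only [Finset.sum_mul, Finset.mul_sum, Algebra.TensorProduct.tmul_mul_tmul,
    Fintype.sum_prod_type, tensorSq]
  exact Finset.sum_comm

/-- The rotated elements `𝐲 𝐭` satisfy the relations of the braided covectors. -/
lemma IsCovector.rotate {R' : Mat₂ n} {y : Fin n → B} (hy : IsCovector R' y)
    {t : Matrix (Fin n) (Fin n) C} (ht : CommutesTensorSq (perm n * R') t) :
    IsCovector R' (fun i => ∑ a, y a ⊗ₜ[ℂ] t a i) := by
  rw [IsCovector]
  simp only [rotated_mul]
  have := rowMul_sum_bilin (TensorProduct.mk ℂ B C) (fun x : Fin n × Fin n => y x.1 * y x.2)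
    (tensorSq t) (perm n * R') ht
  rw [hy] at this
  exact this

/-- The elements `𝐲 𝐭 + 𝐩` satisfy the relations of the braided covectors. -/
lemma IsCovector.rotate_add {R R' : Mat₂ n}
    (hecke : (perm n * R + 1) * (perm n * R' - 1) = 0) {y : Fin n → B} (hy : IsCovector R' y)
    {t : Matrix (Fin n) (Fin n) C} (ht : CommutesTensorSq (perm n * R') t) {p : Fin n → C}
    (hp : IsCovector R' p)
    (hcross : ∀ i k l, p i * t k l = ∑ a, ∑ b, R (a, b) (i, l) • (t k b * p a)) :
    IsCovector R' (fun i => ∑ a, y a ⊗ₜ[ℂ] t a i + 1 ⊗ₜ[ℂ] p i) := by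
  set N : Fin n → Fin n × Fin n → B ⊗[ℂ] C := fun a x => y a ⊗ₜ (t a x.1 * p x.2) with hN
  -- Of the two cross terms, `𝐲 𝐭` times `𝐩` is already in normal form and gives the row `N`;
  -- reordering `𝐩` times `𝐲 𝐭` with `hcross` gives `N · PR`.
  have e : (fun x : Fin n × Fin n => (∑ a, y a ⊗ₜ[ℂ] t a x.1 + 1 ⊗ₜ[ℂ] p x.1) *
      (∑ a, y a ⊗ₜ[ℂ] t a x.2 + 1 ⊗ₜ[ℂ] p x.2)) =
      (fun x => (∑ a, y a ⊗ₜ[ℂ] t a x.1) * (∑ a, y a ⊗ₜ[ℂ] t a x.2)) +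
      (fun x => (1 : B) ⊗ₜ[ℂ] (p x.1 * p x.2)) +
      rowMul (∑ a, N a) (perm n * R + 1) := by
    rw [rowMul_add, rowMul_one]
    ext ⟨j, l⟩
    simp only [Pi.add_apply]
    rw [← sum_eq_rowMul R]
    have h1 : (∑ a, y a ⊗ₜ[ℂ] t a j) * (1 ⊗ₜ[ℂ] p l) = (∑ a, N a) (j, l) := by
      simp [Finset.sum_mul, hN]
    have h2 : (1 ⊗ₜ[ℂ] p j) * (∑ a, y a ⊗ₜ[ℂ] t a l) =
        ∑ i, ∑ k, R (i, k) (j, l) • (∑ a, N a) (k, i) := by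
      simp only [Finset.mul_sum, Algebra.TensorProduct.tmul_mul_tmul, one_mul, hcross,
        TensorProduct.tmul_sum, TensorProduct.tmul_smul, Finset.sum_apply, Finset.smul_sum, hN]
      rw [Finset.sum_comm]
      exact Finset.sum_congr rfl fun a _ => Finset.sum_comm
    rw [add_mul, mul_add, mul_add, h1, h2, Algebra.TensorProduct.tmul_mul_tmul, mul_one]
    abel
  have hq : rowMul (fun x : Fin n × Fin n => (1 : B) ⊗ₜ[ℂ] (p x.1 * p x.2)) (perm n * R') =
      fun x => (1 : B) ⊗ₜ[ℂ] (p x.1 * p x.2) := by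
    ext x
    have := map_rowMul (TensorProduct.mk ℂ B C 1) (fun x : Fin n × Fin n => p x.1 * p x.2)
      (perm n * R') x
    rw [hp] at this
    exact this.symm
  rw [IsCovector, e, add_rowMul, add_rowMul, hy.rotate ht, hq, ← rowMul_mul]
  congr 2
  -- The two quadratic rows are already fixed; for the cross terms what remains is `(PR + 1) PR' =
  -- PR + 1`.
  rw [mul_sub, mul_one, sub_eq_zero] at hecke
  exact hecke

end MatrixAlgebra

/-! ### Universal property of the braided covectors -/

section CovectorAlgebra

variable {n : ℕ} {R' : Mat₂ n} {B : Type*} [Semiring B] [Algebra ℂ B]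

lemma isCovector_gen (R' : Mat₂ n) : IsCovector R' (gen R') := by
  rw [isCovector_iff]
  intro j l
  have := RingQuot.mkAlgHom_rel ℂ (CovectorRel.mk (R' := R') j l)
  simp only [map_mul, map_sum, map_smul] at this
  exact this

lemma IsCovector.map {y : Fin n → B} (hy : IsCovector R' y) {C : Type*} [Semiring C] [Algebra ℂ C]
    (f : B →ₐ[ℂ] C) : IsCovector R' (fun i => f (y i)) := by
  rw [isCovector_iff] at hy ⊢
  intro j l
  rw [← map_mul, hy, map_sum]
  simp only [map_sum, map_smul, map_mul]

/-- The algebra map out of the braided covectors determined by the images of the generators. -/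
def covectorLift (y : Fin n → B) (hy : IsCovector R' y) : Covector R' →ₐ[ℂ] B :=
  RingQuot.liftAlgHom ℂ ⟨FreeAlgebra.lift ℂ y, by
    rintro _ _ ⟨j, l⟩
    simpa only [map_mul, map_sum, map_smul, FreeAlgebra.lift_ι_apply] using
      (isCovector_iff R' y).1 hy j l⟩

@[simp]
lemma covectorLift_gen (y : Fin n → B) (hy : IsCovector R' y) (i : Fin n) :
    covectorLift y hy (gen R' i) = y i := by
  rw [covectorLift, gen, RingQuot.liftAlgHom_mkAlgHom_apply, FreeAlgebra.lift_ι_apply]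

lemma covector_algHom_ext {f g : Covector R' →ₐ[ℂ] B} (h : ∀ i, f (gen R' i) = g (gen R' i)) :
    f = g := by
  refine RingQuot.ringQuot_ext' _ _ _ (FreeAlgebra.hom_ext ?_)
  ext i
  exact h i

lemma adjoin_gen (R' : Mat₂ n) : Algebra.adjoin ℂ (Set.range (gen R')) = ⊤ := by
  have h : Set.range (gen R') =
      RingQuot.mkAlgHom ℂ (CovectorRel R') '' Set.range (FreeAlgebra.ι ℂ) := by
    rw [← Set.range_comp]
    rfl
  rw [h, ← AlgHom.map_adjoin, FreeAlgebra.adjoin_range_ι, Algebra.map_top,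
    AlgHom.range_eq_top]
  exact RingQuot.mkAlgHom_surjective ℂ _

@[elab_as_elim]
lemma covector_induction {q : Covector R' → Prop} (v : Covector R') (hgen : ∀ i, q (gen R' i))
    (halg : ∀ c, q (algebraMap ℂ _ c)) (hadd : ∀ v w, q v → q w → q (v + w))
    (hmul : ∀ v w, q v → q w → q (v * w)) : q v := by
  have hv : v ∈ Algebra.adjoin ℂ (Set.range (gen R')) := adjoin_gen R' ▸ Algebra.mem_top
  induction hv using Algebra.adjoin_induction with
  | mem x hx =>
    obtain ⟨i, rfl⟩ := hx
    exact hgen i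
  | algebraMap c => exact halg c
  | add x y _ _ hx hy => exact hadd x y hx hy
  | mul x y _ _ hx hy => exact hmul x y hx hy

end CovectorAlgebra

/-! ### Contraction against a dual quasitriangular form -/

section ContractHom

variable {H : Type*} [Ring H] [HopfAlgebra ℂ H] {r : H →ₗ[ℂ] H →ₗ[ℂ] ℂ}

open Coalgebra

/-- The representation `h ↦ (a ↦ a₍₁₎ 𝓡(h ⊗ a₍₂₎))`. -/
def contractHom (hr : IsCoquasitriangular r) : H →ₐ[ℂ] Module.End ℂ H :=
  AlgHom.ofLinearMap
    { toFun := fun h => rightContract (r h)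
      map_add' := fun x y => by
        rw [rightContract, map_add, LinearMap.lTensor_add, LinearMap.add_comp, LinearMap.comp_add]
        rfl
      map_smul' := fun c x => by
        rw [rightContract, map_smul, LinearMap.lTensor_smul, LinearMap.smul_comp,
          LinearMap.comp_smul]
        rfl }
    (by
      have : r 1 = counit := LinearMap.ext hr.one_left
      simp only [LinearMap.coe_mk, AddHom.coe_mk, this, rightContract_counit]
      rfl)
    (fun x y => by
      ext a
      simp only [LinearMap.coe_mk, AddHom.coe_mk, Module.End.mul_apply,
        rightContract_rightContract]
      congr 2
      ext c
      exact hr.mul_left x y c)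

lemma rightContract_one (f : H →ₗ[ℂ] ℂ) : rightContract f 1 = f 1 • 1 := by
  simp [rightContract, Algebra.TensorProduct.one_def]

/-- The second argument of `𝓡` is antimultiplicative, hence `v` goes with `a` and `u` with `b`. For
`h = t^k_i g` this says that the cross relations are compatible with products in `Ã`. -/
lemma IsCoquasitriangular.rightContract_mul (hr : IsCoquasitriangular r) {ι : Type*} [Fintype ι]
    {h : H} {u v : ι → H} (hh : comul (R := ℂ) h = ∑ j, u j ⊗ₜ[ℂ] v j) (a b : H) :
    rightContract (r h) (a * b) = ∑ j, rightContract (r (v j)) a * rightContract (r (u j)) b := by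
  have hmul : ∀ x y, r h (x * y) = ∑ j, r (v j) x * r (u j) y := by
    intro x y
    rw [hr.mul_right, hh]
    simp [mul_comm]
  simp only [rightContract, LinearMap.comp_apply, Bialgebra.comul_mul]
  generalize (comul a : H ⊗[ℂ] H) = X
  generalize (comul b : H ⊗[ℂ] H) = Y
  induction X with
  | zero => simp
  | add x y hx hy => simp only [map_add, add_mul, hx, hy, Finset.sum_add_distrib]
  | tmul a b =>
  induction Y with
  | zero => simp
  | add x y hx hy => simp only [map_add, mul_add, hx, hy, Finset.sum_add_distrib]
  | tmul c d => simp [hmul, Finset.sum_smul, smul_smul, mul_comm]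

end ContractHom

end QPoincare

end

noncomputable section

namespace QPoincare

open Coalgebra

/-! ### The matrix `𝐭 g` and the cross coefficients in `Ã` -/

variable {A : Type*} [Ring A] [HopfAlgebra ℂ A] {n : ℕ}

/-- The matrix `𝐭 g` in `Ã`. -/
def rotMat (t : Matrix (Fin n) (Fin n) A) : Matrix (Fin n) (Fin n) (Ext A) :=
  fun i j => toExt (t i j) * dil

/-- The hypotheses on `R`, `R'`, `𝓡` and `𝐭` used in the construction of the Poincaré group. -/
structure IsPoincareData (R R' : Mat₂ n) (𝓡 : A →ₗ[ℂ] A →ₗ[ℂ] ℂ) (lam : ℂ)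
    (t : Matrix (Fin n) (Fin n) A) : Prop where
  form : IsDualQuasitriangular 𝓡
  coalgebra : IsMatrixCoalgebra t
  lam_ne : lam ≠ 0
  form_apply : ∀ i j k l, 𝓡 (t i j) (t k l) = lam * R (i, k) (j, l)
  hecke : (perm n * R + 1) * (perm n * R' - 1) = 0
  commutes : MatrixCommutes R' t

lemma rotMat_eq (t : Matrix (Fin n) (Fin n) A) (i j : Fin n) :
    rotMat t i j = t i j ⊗ₜ LaurentPolynomial.T 1 := by
  simp [rotMat, toExt, dil]

lemma extForm_tmul (𝓡 : A →ₗ[ℂ] A →ₗ[ℂ] ℂ) (lam : ℂ) (a b : A) (x y : ℂ[T;T⁻¹]) :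
    extForm 𝓡 lam (a ⊗ₜ x) (b ⊗ₜ y) = 𝓡 a b * dilatonForm lam x y := by
  simp [extForm, mul_comm]

lemma leftContract_dilatonForm_T (lam : ℂ) (m k : ℤ) :
    leftContract (dilatonForm lam (LaurentPolynomial.T m)) (LaurentPolynomial.T k) =
      lam ^ (-(m * k)) • LaurentPolynomial.T k := by
  simp [leftContract, dilatonForm_T]

lemma rightContract_dilatonForm_T (lam : ℂ) (m k : ℤ) :
    rightContract (dilatonForm lam (LaurentPolynomial.T m)) (LaurentPolynomial.T k) =
      lam ^ (-(m * k)) • LaurentPolynomial.T k := by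
  simp [rightContract, dilatonForm_T]

lemma crossCoeff_eq (𝓡 : A →ₗ[ℂ] A →ₗ[ℂ] ℂ) (lam : ℂ) (t : Matrix (Fin n) (Fin n) A)
    (j i : Fin n) :
    crossCoeff 𝓡 lam t j i = rightContract (extForm 𝓡 lam (rotMat t j i)) := rfl

namespace IsMatrixCoalgebra

variable {t : Matrix (Fin n) (Fin n) A}

lemma comul_rotMat (ht : IsMatrixCoalgebra t) (i j : Fin n) :
    Coalgebra.comul (R := ℂ) (rotMat t i j) = ∑ a, rotMat t i a ⊗ₜ[ℂ] rotMat t a j := by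
  simp only [rotMat_eq, TensorProduct.comul_tmul, ht.comul, comul_T, TensorProduct.sum_tmul,
    map_sum]
  rfl

lemma counit_rotMat (ht : IsMatrixCoalgebra t) (i j : Fin n) :
    Coalgebra.counit (R := ℂ) (rotMat t i j) = if i = j then 1 else 0 := by
  simp [rotMat_eq, ht.counit]

end IsMatrixCoalgebra

namespace IsPoincareData

variable {R R' : Mat₂ n} {𝓡 : A →ₗ[ℂ] A →ₗ[ℂ] ℂ} {lam : ℂ} {t : Matrix (Fin n) (Fin n) A}

lemma isCoquasitriangular (d : IsPoincareData R R' 𝓡 lam t) : IsCoquasitriangular (extForm 𝓡 lam) := d.form.extForm d.lam_ne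

/-- The dilaton contributes `λ⁻¹`, which cancels the factor in `𝓡(𝐭₁ ⊗ 𝐭₂) = λ R`. This is the
reason for adjoining `g`. -/
lemma extForm_rotMat (d : IsPoincareData R R' 𝓡 lam t) (i j k l : Fin n) :
    extForm 𝓡 lam (rotMat t i j) (rotMat t k l) = R (i, k) (j, l) := by
  rw [rotMat_eq, rotMat_eq, extForm_tmul, dilatonForm_T, d.form_apply]
  have := d.lam_ne
  simp only [mul_one, zpow_neg_one]
  field_simp

lemma crossCoeff_rotMat (d : IsPoincareData R R' 𝓡 lam t) (j i k l : Fin n) :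
    crossCoeff 𝓡 lam t j i (rotMat t k l) = ∑ b, R (j, b) (i, l) • rotMat t k b := by
  rw [crossCoeff_eq, rightContract, LinearMap.comp_apply, LinearMap.comp_apply,
    d.coalgebra.comul_rotMat]
  simp [d.extForm_rotMat]

lemma crossCoeff_toExt (d : IsPoincareData R R' 𝓡 lam t) (j i k l : Fin n) :
    crossCoeff 𝓡 lam t j i (toExt (t k l)) = ∑ b, (lam * R (j, b) (i, l)) • toExt (t k b) := by
  rw [crossCoeff_eq, toExt, rightContract_tmul (𝓡 (t j i)) (dilatonForm lam (.T 1)),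
    ← LaurentPolynomial.T_zero, rightContract_dilatonForm_T]
  · simp [rightContract, d.coalgebra.comul, TensorProduct.sum_tmul, d.form_apply,
      TensorProduct.smul_tmul', toExt]
  · intro x y
    rw [rotMat_eq, extForm_tmul]

lemma crossCoeff_dil (d : IsPoincareData R R' 𝓡 lam t) (j i : Fin n) :
    crossCoeff 𝓡 lam t j i dil = (if j = i then lam⁻¹ else 0) • dil := by
  rw [crossCoeff_eq, dil, rightContract_tmul (𝓡 (t j i)) (dilatonForm lam (.T 1)),
    rightContract_dilatonForm_T, rightContract_one, d.form.isCoquasitriangular.one_right,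
    d.coalgebra.counit]
  · split_ifs <;> simp
  · intro x y
    rw [rotMat_eq, extForm_tmul]

lemma crossCoeff_one (d : IsPoincareData R R' 𝓡 lam t) (j i : Fin n) :
    crossCoeff 𝓡 lam t j i 1 = (if j = i then 1 else 0 : ℂ) • 1 := by
  rw [crossCoeff_eq, rightContract_one, d.isCoquasitriangular.one_right,
    d.coalgebra.counit_rotMat]

lemma crossCoeff_mul (d : IsPoincareData R R' 𝓡 lam t) (k i : Fin n) (a b : Ext A) :
    crossCoeff 𝓡 lam t k i (a * b) =
      ∑ j, crossCoeff 𝓡 lam t j i a * crossCoeff 𝓡 lam t k j b :=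
  d.isCoquasitriangular.rightContract_mul (d.coalgebra.comul_rotMat k i) a b

/-- On a power of `g` the left and right contractions multiply by the same scalar, and powers of `g`
commute, so the identity descends to quasicommutativity in `A`. It makes the coproduct and the
antipode compatible with the cross relations. -/
lemma sum_rotMat_mul_leftContract (d : IsPoincareData R R' 𝓡 lam t)
    (k i : Fin n) (a : Ext A) :
    ∑ j, rotMat t j i * leftContract (extForm 𝓡 lam (rotMat t k j)) a =
      ∑ j, crossCoeff 𝓡 lam t j i a * rotMat t k j := by
  induction a using TensorProduct.induction_on with
  | zero => simp
  | add x y hx hy => simp only [map_add, mul_add, add_mul, Finset.sum_add_distrib, hx, hy]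
  | tmul a x =>
    induction x using laurent_induction with
    | hadd x y hx hy =>
      simp only [TensorProduct.tmul_add, map_add, mul_add, add_mul, Finset.sum_add_distrib, hx, hy]
    | hsmul c x hx =>
      simp only [TensorProduct.tmul_smul, map_smul, mul_smul_comm, smul_mul_assoc,
        ← Finset.smul_sum, hx]
    | hT m =>
      have hF : ∀ i j x y, extForm 𝓡 lam (rotMat t i j) (x ⊗ₜ y) =
          𝓡 (t i j) x * dilatonForm lam (.T 1) y := fun i j x y => by
        rw [rotMat_eq, extForm_tmul]
      simp only [crossCoeff_eq, rightContract_tmul _ _ _ (hF _ _), leftContract_tmul _ _ _ (hF _ _),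
        rightContract_dilatonForm_T, leftContract_dilatonForm_T]
      simp only [rotMat_eq, Algebra.TensorProduct.tmul_mul_tmul, mul_smul_comm, smul_mul_assoc,
        TensorProduct.tmul_smul, ← Finset.smul_sum, ← TensorProduct.sum_tmul, ← LaurentPolynomial.T_add, add_comm,
        d.form.sum_mul_leftContract d.coalgebra]

lemma commutesTensorSq_rotMat (d : IsPoincareData R R' 𝓡 lam t) : CommutesTensorSq (perm n * R') (rotMat t) := by
  intro x z
  have h := congrArg (fun a : A => a ⊗ₜ[ℂ] (LaurentPolynomial.T 2 : ℂ[T;T⁻¹]))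
    ((matrixCommutes_iff R' t).1 d.commutes x z)
  have e : ∀ x y, tensorSq (rotMat t) x y = tensorSq t x y ⊗ₜ LaurentPolynomial.T 2 := by
    intro x y
    simp only [tensorSq, rotMat_eq, Algebra.TensorProduct.tmul_mul_tmul,
      ← LaurentPolynomial.T_add]
    rfl
  simpa only [e, TensorProduct.sum_tmul, TensorProduct.smul_tmul'] using h

end IsPoincareData

/-! ### Universal property of the semidirect product -/

section PoincareAlgebra

variable {R' : Mat₂ n} {𝓡 : A →ₗ[ℂ] A →ₗ[ℂ] ℂ} {lam : ℂ} {t : Matrix (Fin n) (Fin n) A}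
  {B : Type*} [Semiring B] [Algebra ℂ B]

lemma momentum_gen (i : Fin n) : momentum R' 𝓡 lam t (gen R' i) =
    RingQuot.mkAlgHom ℂ (PoincareRel R' 𝓡 lam t) (FreeAlgebra.ι ℂ (Sum.inl i)) := by
  rw [momentum, gen, RingQuot.liftAlgHom_mkAlgHom_apply, FreeAlgebra.lift_ι_apply]

lemma rotation_apply (a : Ext A) : rotation R' 𝓡 lam t a =
    RingQuot.mkAlgHom ℂ (PoincareRel R' 𝓡 lam t) (FreeAlgebra.ι ℂ (Sum.inr a)) := rfl

lemma momentum_mul_rotation (i : Fin n) (a : Ext A) :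
    momentum R' 𝓡 lam t (gen R' i) * rotation R' 𝓡 lam t a =
      ∑ j, rotation R' 𝓡 lam t (crossCoeff 𝓡 lam t j i a) * momentum R' 𝓡 lam t (gen R' j) := by
  simp only [momentum_gen, rotation_apply, ← map_mul, ← map_sum]
  exact RingQuot.mkAlgHom_rel ℂ (PoincareRel.cross i a)

/-- The algebra map out of `V*(R') ⋊ Ã` determined by an algebra map out of `Ã` and the images of
the generators `p_i`. -/
def poincareLift (f : Ext A →ₐ[ℂ] B) (y : Fin n → B) (hy : IsCovector R' y)
    (hcross : ∀ i a, y i * f a = ∑ j, f (crossCoeff 𝓡 lam t j i a) * y j) :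
    Poincare R' 𝓡 lam t →ₐ[ℂ] B :=
  RingQuot.liftAlgHom ℂ ⟨FreeAlgebra.lift ℂ (Sum.elim y f), by
    intro x z h
    cases h with
    | add a b => simp
    | smul c a => simp
    | one => simp
    | mul a b => simp
    | momentum j l =>
      simpa only [map_mul, map_sum, map_smul, FreeAlgebra.lift_ι_apply, Sum.elim_inl] using
        (isCovector_iff R' y).1 hy j l
    | cross i a =>
      simpa only [map_mul, map_sum, FreeAlgebra.lift_ι_apply, Sum.elim_inl, Sum.elim_inr] using
        hcross i a⟩

@[simp]
lemma poincareLift_momentum (f : Ext A →ₐ[ℂ] B) (y : Fin n → B) (hy : IsCovector R' y)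
    (hcross : ∀ i a, y i * f a = ∑ j, f (crossCoeff 𝓡 lam t j i a) * y j) (i : Fin n) :
    poincareLift f y hy hcross (momentum R' 𝓡 lam t (gen R' i)) = y i := by
  rw [momentum_gen, poincareLift, RingQuot.liftAlgHom_mkAlgHom_apply, FreeAlgebra.lift_ι_apply,
    Sum.elim_inl]

@[simp]
lemma poincareLift_rotation (f : Ext A →ₐ[ℂ] B) (y : Fin n → B) (hy : IsCovector R' y)
    (hcross : ∀ i a, y i * f a = ∑ j, f (crossCoeff 𝓡 lam t j i a) * y j) (a : Ext A) :
    poincareLift f y hy hcross (rotation R' 𝓡 lam t a) = f a := by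
  rw [rotation_apply, poincareLift, RingQuot.liftAlgHom_mkAlgHom_apply, FreeAlgebra.lift_ι_apply,
    Sum.elim_inr]

lemma poincare_algHom_ext {f g : Poincare R' 𝓡 lam t →ₐ[ℂ] B}
    (hp : ∀ i, f (momentum R' 𝓡 lam t (gen R' i)) = g (momentum R' 𝓡 lam t (gen R' i)))
    (hr : ∀ a, f (rotation R' 𝓡 lam t a) = g (rotation R' 𝓡 lam t a)) : f = g := by
  refine RingQuot.ringQuot_ext' _ _ _ (FreeAlgebra.hom_ext ?_)
  ext x
  cases x with
  | inl i =>
    have := hp i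
    rw [momentum_gen] at this
    exact this
  | inr a => exact hr a

@[elab_as_elim]
lemma poincare_induction {q : Poincare R' 𝓡 lam t → Prop} (v : Poincare R' 𝓡 lam t)
    (hp : ∀ i, q (momentum R' 𝓡 lam t (gen R' i))) (hr : ∀ a, q (rotation R' 𝓡 lam t a))
    (hadd : ∀ v w, q v → q w → q (v + w)) (hmul : ∀ v w, q v → q w → q (v * w)) : q v := by
  obtain ⟨v, rfl⟩ := RingQuot.mkAlgHom_surjective ℂ _ v
  induction v using FreeAlgebra.induction with
  | grade0 c =>
    -- Scalars already lie in the image of `Ã`, so the induction needs no case of its own for them.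
    have := hr (algebraMap ℂ _ c)
    rwa [AlgHom.commutes] at this ⊢
  | grade1 x =>
    cases x with
    | inl i =>
      have := hp i
      rwa [momentum_gen] at this
    | inr a => exact hr a
  | mul a b ha hb =>
    rw [map_mul]
    exact hmul _ _ ha hb
  | add a b ha hb =>
    rw [map_add]
    exact hadd _ _ ha hb

lemma normalOrder_tmul (a : Ext A) (v : Covector R') :
    normalOrder R' 𝓡 lam t (a ⊗ₜ v) = rotation R' 𝓡 lam t a * momentum R' 𝓡 lam t v := rfl

end PoincareAlgebra

/-! ### The representation on `Ã ⊗ V*(R')` and normal ordering -/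

namespace IsPoincareData

variable {R R' : Mat₂ n} {𝓡 : A →ₗ[ℂ] A →ₗ[ℂ] ℂ} {lam : ℂ} {t : Matrix (Fin n) (Fin n) A}
  (d : IsPoincareData R R' 𝓡 lam t)

/-- The coaction of `Ã` on the braided covectors. -/
def rotationCoaction : Covector R' →ₐ[ℂ] Covector R' ⊗[ℂ] Ext A :=
  covectorLift (fun i => ∑ a, gen R' a ⊗ₜ rotMat t a i)
    ((isCovector_gen R').rotate d.commutesTensorSq_rotMat)

lemma rotationCoaction_gen (i : Fin n) :
    d.rotationCoaction (gen R' i) = ∑ a, gen R' a ⊗ₜ rotMat t a i :=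
  covectorLift_gen _ _ i

/-- The action of the braided covectors on `Ã ⊗ V*(R')` by
`b ↦ (a ⊗ v ↦ a₍₁₎ ⊗ b⁽¹⁾ v 𝓡(b⁽²⁾ ⊗ a₍₂₎))`. -/
def covectorAction : Covector R' →ₐ[ℂ] Module.End ℂ (Ext A ⊗[ℂ] Covector R') :=
  Module.endTensorEndAlgHom.comp <|
    (Algebra.TensorProduct.map (contractHom d.isCoquasitriangular)
      (Algebra.lmul ℂ (Covector R'))).comp <|
    (Algebra.TensorProduct.comm ℂ (Covector R') (Ext A)).toAlgHom.comp d.rotationCoaction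

lemma covectorAction_gen (i : Fin n) (a : Ext A) (v : Covector R') :
    d.covectorAction (gen R' i) (a ⊗ₜ v) =
      ∑ j, crossCoeff 𝓡 lam t j i a ⊗ₜ (gen R' j * v) := by
  simp only [covectorAction, AlgHom.comp_apply, rotationCoaction_gen, map_sum]
  rw [LinearMap.sum_apply]
  rfl

/-- Left multiplication of `Ã` on the first factor of `Ã ⊗ V*(R')`. -/
def rotationAction (R' : Mat₂ n) : Ext A →ₐ[ℂ] Module.End ℂ (Ext A ⊗[ℂ] Covector R') :=
  (Module.End.rTensorAlgHom ℂ (Ext A) (Covector R')).comp (Algebra.lmul ℂ (Ext A))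

lemma rotationAction_tmul (R' : Mat₂ n) (a b : Ext A) (v : Covector R') :
    rotationAction R' a (b ⊗ₜ v) = (a * b) ⊗ₜ v := rfl

/-- This is `crossCoeff_mul` read as an identity of operators; with it the cross relations hold in
the representation. -/
lemma covectorAction_mul_rotationAction (i : Fin n) (a : Ext A) :
    d.covectorAction (gen R' i) * rotationAction R' a =
      ∑ j, rotationAction R' (crossCoeff 𝓡 lam t j i a) * d.covectorAction (gen R' j) := by
  refine TensorProduct.ext' fun b v => ?_
  rw [LinearMap.sum_apply]
  simp only [Module.End.mul_apply, rotationAction_tmul, covectorAction_gen, d.crossCoeff_mul,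
    TensorProduct.sum_tmul, map_sum]
  exact Finset.sum_comm

/-- The action of `V*(R') ⋊ Ã` on `Ã ⊗ V*(R')`. -/
def poincareAction : Poincare R' 𝓡 lam t →ₐ[ℂ] Module.End ℂ (Ext A ⊗[ℂ] Covector R') :=
  poincareLift (rotationAction R') (fun i => d.covectorAction (gen R' i))
    ((isCovector_gen R').map d.covectorAction) d.covectorAction_mul_rotationAction

lemma poincareAction_rotation (a b : Ext A) (v : Covector R') :
    d.poincareAction (rotation R' 𝓡 lam t a) (b ⊗ₜ v) = (a * b) ⊗ₜ v := by
  rw [poincareAction, poincareLift_rotation]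
  rfl

lemma poincareAction_momentum (v : Covector R') :
    d.poincareAction (momentum R' 𝓡 lam t v) = d.covectorAction v := by
  have : d.poincareAction.comp (momentum R' 𝓡 lam t) = d.covectorAction :=
    covector_algHom_ext fun i => by
      rw [AlgHom.comp_apply, poincareAction, poincareLift_momentum]
  rw [← this, AlgHom.comp_apply]

/-- Contracting `1` against `𝐭 g` gives the counit `δ^j_i`, so covectors pass the unit of `Ã`
unchanged. -/
lemma covectorAction_one_tmul (v w : Covector R') :
    d.covectorAction v (1 ⊗ₜ w) = 1 ⊗ₜ (v * w) := by
  induction v using covector_induction generalizing w with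
  | hgen i => simp [covectorAction_gen, d.crossCoeff_one, TensorProduct.ite_tmul]
  | halg c => simp [Algebra.algebraMap_eq_smul_one]
  | hadd v w hv hw => simp only [map_add, LinearMap.add_apply, hv, hw, add_mul,
      TensorProduct.tmul_add]
  | hmul v w hv hw => rw [map_mul, Module.End.mul_apply, hw, hv, mul_assoc]

lemma normalOrder_covectorAction (v : Covector R') (w : Ext A ⊗[ℂ] Covector R') :
    normalOrder R' 𝓡 lam t (d.covectorAction v w) =
      momentum R' 𝓡 lam t v * normalOrder R' 𝓡 lam t w := by
  induction v using covector_induction generalizing w with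
  | hgen i =>
    induction w with
    | zero => simp
    | add x y hx hy => simp only [map_add, hx, hy, mul_add]
    | tmul a v =>
      rw [covectorAction_gen, map_sum, normalOrder_tmul, ← mul_assoc, momentum_mul_rotation,
        Finset.sum_mul]
      simp only [normalOrder_tmul, map_mul, mul_assoc]
  | halg c => simp [Algebra.algebraMap_eq_smul_one]
  | hadd v w hv hw => simp only [map_add, LinearMap.add_apply, hv, hw, add_mul]
  | hmul v w hv hw => rw [map_mul, Module.End.mul_apply, hv, hw, map_mul, mul_assoc]

/-- The action was modelled on reordering products, so normal ordering is a map of left modules to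
the regular one. This gives surjectivity. -/
lemma normalOrder_poincareAction (h : Poincare R' 𝓡 lam t) (w : Ext A ⊗[ℂ] Covector R') :
    normalOrder R' 𝓡 lam t (d.poincareAction h w) = h * normalOrder R' 𝓡 lam t w := by
  induction h using poincare_induction generalizing w with
  | hp i => rw [poincareAction_momentum, normalOrder_covectorAction]
  | hr a =>
    induction w with
    | zero => simp
    | add x y hx hy => simp only [map_add, hx, hy, mul_add]
    | tmul b v => rw [poincareAction_rotation, normalOrder_tmul, normalOrder_tmul, map_mul,
        mul_assoc]
  | hadd v w hv hw => simp only [map_add, LinearMap.add_apply, hv, hw, add_mul]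
  | hmul v w hv hw => rw [map_mul, Module.End.mul_apply, hv, hw, mul_assoc]

/-- The inverse of the normal ordering map. -/
def denormalOrder : Poincare R' 𝓡 lam t →ₗ[ℂ] Ext A ⊗[ℂ] Covector R' :=
  LinearMap.applyₗ (1 ⊗ₜ 1 : Ext A ⊗[ℂ] Covector R') ∘ₗ d.poincareAction.toLinearMap

lemma denormalOrder_normalOrder (w : Ext A ⊗[ℂ] Covector R') :
    d.denormalOrder (normalOrder R' 𝓡 lam t w) = w := by
  induction w with
  | zero => simp
  | add x y hx hy => simp only [map_add, hx, hy]
  | tmul a v =>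
    rw [normalOrder_tmul, denormalOrder, LinearMap.comp_apply, AlgHom.toLinearMap_apply, map_mul,
      LinearMap.applyₗ_apply_apply, Module.End.mul_apply, poincareAction_momentum,
      covectorAction_one_tmul, poincareAction_rotation, mul_one, mul_one]

/-- Acting with `a v` on `1 ⊗ 1` returns `a ⊗ v`, which gives injectivity. Conversely, normal
ordering is a module map sending `1 ⊗ 1` to `1`, so the image of `h · (1 ⊗ 1)` is `h`. -/
lemma normalOrder_bijective (d : IsPoincareData R R' 𝓡 lam t) :
    Function.Bijective (normalOrder R' 𝓡 lam t) := by
  refine ⟨Function.LeftInverse.injective d.denormalOrder_normalOrder, fun h =>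
    ⟨d.denormalOrder h, ?_⟩⟩
  have := d.normalOrder_poincareAction h (1 ⊗ₜ 1)
  rw [normalOrder_tmul, map_one, map_one, mul_one, mul_one] at this
  exact this

end IsPoincareData

end QPoincare

end

noncomputable section

namespace QPoincare

open Coalgebra

/-! ### Convolution of linear maps into an algebra -/

section Convolution

variable {C B : Type*} [AddCommGroup C] [Module ℂ C] [Coalgebra ℂ C] [Ring B] [Algebra ℂ B]

/-- The convolution product of linear maps from a coalgebra to an algebra. -/
def conv (f g : C →ₗ[ℂ] B) : C →ₗ[ℂ] B :=
  LinearMap.mul' ℂ B ∘ₗ TensorProduct.map f g ∘ₗ comul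

lemma conv_assoc (f g h : C →ₗ[ℂ] B) : conv (conv f g) h = conv f (conv g h) :=
  congrArg WithConv.ofConv (mul_assoc (WithConv.toConv f) (WithConv.toConv g) (WithConv.toConv h))

lemma conv_comp_rightContract (f g : C →ₗ[ℂ] B) (φ : C →ₗ[ℂ] ℂ) (a : C) :
    conv f g (rightContract φ a) = conv f (g ∘ₗ rightContract φ) a := by
  rw [conv, LinearMap.comp_apply, LinearMap.comp_apply, comul_rightContract, conv,
    LinearMap.comp_apply, LinearMap.comp_apply]
  congr 1
  generalize (comul a : C ⊗[ℂ] C) = X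
  induction X with
  | zero => simp
  | add x y hx hy => simp only [map_add, hx, hy]
  | tmul x y => simp

end Convolution

/-! ### Tensor maps as algebra maps, so that identities can be checked on generators -/

section TensorMaps

variable {B C D : Type*} [Ring B] [Algebra ℂ B] [Ring C] [Algebra ℂ C] [Ring D] [Algebra ℂ D]

lemma rTensor_toLinearMap (f : B →ₐ[ℂ] C) :
    f.toLinearMap.rTensor D = (Algebra.TensorProduct.map f (AlgHom.id ℂ D)).toLinearMap := by
  ext; rfl

lemma lTensor_toLinearMap (f : B →ₐ[ℂ] C) :
    f.toLinearMap.lTensor D = (Algebra.TensorProduct.map (AlgHom.id ℂ D) f).toLinearMap := by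
  ext; rfl

lemma assoc_toLinearMap : (TensorProduct.assoc ℂ B C D).toLinearMap =
    (Algebra.TensorProduct.assoc ℂ ℂ ℂ B C D).toAlgHom.toLinearMap := by
  ext; rfl

lemma rid_toLinearMap : (TensorProduct.rid ℂ B).toLinearMap =
    (Algebra.TensorProduct.rid ℂ ℂ B).toAlgHom.toLinearMap := by
  ext; rfl

lemma lid_toLinearMap : (TensorProduct.lid ℂ B).toLinearMap =
    (Algebra.TensorProduct.lid ℂ B).toAlgHom.toLinearMap := by
  ext; rfl

end TensorMaps

variable {A : Type*} [Ring A] [HopfAlgebra ℂ A] {n : ℕ}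

/-! ### Coproduct and counit of the semidirect product -/

namespace IsPoincareData

variable {R R' : Mat₂ n} {𝓡 : A →ₗ[ℂ] A →ₗ[ℂ] ℂ} {lam : ℂ} {t : Matrix (Fin n) (Fin n) A}

lemma momentum_mul_rotMat (d : IsPoincareData R R' 𝓡 lam t) (i k l : Fin n) :
    momentum R' 𝓡 lam t (gen R' i) * rotation R' 𝓡 lam t (rotMat t k l) =
      ∑ a, ∑ b, R (a, b) (i, l) •
        (rotation R' 𝓡 lam t (rotMat t k b) * momentum R' 𝓡 lam t (gen R' a)) := by
  rw [momentum_mul_rotation]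
  simp only [d.crossCoeff_rotMat, map_sum, map_smul, Finset.sum_mul, smul_mul_assoc]

lemma isCovector_momentum : IsCovector R' (fun i => momentum R' 𝓡 lam t (gen R' i)) :=
  (isCovector_gen R').map _

/-- The images `𝐲 𝐭 g + 𝐩` of the generators under a rotation and translation are again braided
covectors. -/
lemma isCovector_transform (d : IsPoincareData R R' 𝓡 lam t) {B : Type*} [Semiring B] [Algebra ℂ B]
    {y : Fin n → B} (hy : IsCovector R' y) :
    IsCovector R' (fun i => ∑ a, y a ⊗ₜ[ℂ] rotation R' 𝓡 lam t (rotMat t a i) +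
      1 ⊗ₜ[ℂ] momentum R' 𝓡 lam t (gen R' i)) :=
  hy.rotate_add d.hecke (d.commutesTensorSq_rotMat.map (rotation R' 𝓡 lam t))
    isCovector_momentum d.momentum_mul_rotMat

/-- The coproduct of `V*(R') ⋊ Ã` restricted to `Ã`. -/
def rotationComul (R' : Mat₂ n) (𝓡 : A →ₗ[ℂ] A →ₗ[ℂ] ℂ) (lam : ℂ) (t : Matrix (Fin n) (Fin n) A) :
    Ext A →ₐ[ℂ] Poincare R' 𝓡 lam t ⊗[ℂ] Poincare R' 𝓡 lam t :=
  (Algebra.TensorProduct.map (rotation R' 𝓡 lam t) (rotation R' 𝓡 lam t)).comp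
    (Bialgebra.comulAlgHom ℂ (Ext A))

lemma rotationComul_apply (a : Ext A) : rotationComul R' 𝓡 lam t a =
    Algebra.TensorProduct.map (rotation R' 𝓡 lam t) (rotation R' 𝓡 lam t) (comul a) := rfl

/-- In Sweedler notation the left side is `a₍₁₎ p_k 𝓡(t^k_j g ⊗ a₍₂₎) ⊗ t^j_i g a₍₃₎`.
Quasicommutativity in the second tensor factor replaces `𝓡(t^k_j g ⊗ a₍₂₎) t^j_i g a₍₃₎` by `a₍₂₎
𝓡(t^j_i g ⊗ a₍₃₎) t^k_j g`, and coassociativity recognises the coproduct of the cross coefficient.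
-/
lemma rotated_momentum_mul (d : IsPoincareData R R' 𝓡 lam t) (i : Fin n) (a : Ext A) :
    (∑ j, momentum R' 𝓡 lam t (gen R' j) ⊗ₜ[ℂ] rotation R' 𝓡 lam t (rotMat t j i)) *
        rotationComul R' 𝓡 lam t a =
      ∑ j, rotationComul R' 𝓡 lam t (crossCoeff 𝓡 lam t j i a) *
        ∑ k, momentum R' 𝓡 lam t (gen R' k) ⊗ₜ[ℂ] rotation R' 𝓡 lam t (rotMat t k j) := by
  set rot := rotation R' 𝓡 lam t
  set M := Algebra.TensorProduct.map rot rot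
  have h1 : ∀ X : Ext A ⊗[ℂ] Ext A,
      (∑ j, momentum R' 𝓡 lam t (gen R' j) ⊗ₜ[ℂ] rot (rotMat t j i)) * M X =
        ∑ k, (∑ j, (1 ⊗ₜ rot (rotMat t j i)) * M ((crossCoeff 𝓡 lam t k j).rTensor _ X)) *
          (momentum R' 𝓡 lam t (gen R' k) ⊗ₜ 1) := by
    intro X
    induction X with
    | zero => simp
    | add x y hx hy => simp only [map_add, mul_add, add_mul, Finset.sum_add_distrib, hx, hy]
    | tmul b c =>
      simp only [M, rot, Finset.sum_mul, Algebra.TensorProduct.map_tmul, LinearMap.rTensor_tmul,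
        Algebra.TensorProduct.tmul_mul_tmul, momentum_mul_rotation, one_mul, mul_one,
        TensorProduct.sum_tmul]
      exact Finset.sum_comm
  have h2 : ∀ (k : Fin n) (X : Ext A ⊗[ℂ] Ext A),
      ∑ j, (1 ⊗ₜ rot (rotMat t j i)) *
        M ((leftContract (extForm 𝓡 lam (rotMat t k j))).lTensor _ X) =
      ∑ j, M ((crossCoeff 𝓡 lam t j i).lTensor _ X) * (1 ⊗ₜ rot (rotMat t k j)) := by
    intro k X
    induction X with
    | zero => simp
    | add x y hx hy => simp only [map_add, mul_add, add_mul, Finset.sum_add_distrib, hx, hy]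
    | tmul b c =>
      simp only [M, Algebra.TensorProduct.map_tmul, LinearMap.lTensor_tmul,
        Algebra.TensorProduct.tmul_mul_tmul, one_mul, mul_one, ← TensorProduct.tmul_sum,
        ← map_mul, ← map_sum, d.sum_rotMat_mul_leftContract]
  rw [rotationComul_apply, h1]
  -- The contraction moves from the first leg to a left contraction on the second, where `h2`
  -- applies.
  simp only [crossCoeff_eq, rotationComul_apply, rTensor_rightContract_comul, comul_rightContract]
  simp only [h2, Finset.sum_mul, Finset.mul_sum]
  rw [Finset.sum_comm]
  refine Finset.sum_congr rfl fun j _ => Finset.sum_congr rfl fun k _ => ?_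
  rw [mul_assoc, Algebra.TensorProduct.tmul_mul_tmul, one_mul, mul_one]
  rfl

/-- Only the second leg of the coproduct meets `p_i`, and contraction acts on that leg alone by
`comul_rightContract`. -/
lemma translation_mul (i : Fin n) (a : Ext A) :
    (1 ⊗ₜ[ℂ] momentum R' 𝓡 lam t (gen R' i)) * rotationComul R' 𝓡 lam t a =
      ∑ j, rotationComul R' 𝓡 lam t (crossCoeff 𝓡 lam t j i a) *
        (1 ⊗ₜ[ℂ] momentum R' 𝓡 lam t (gen R' j)) := by
  simp only [crossCoeff_eq, rotationComul_apply, comul_rightContract]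
  simp only [← crossCoeff_eq]
  generalize (comul a : Ext A ⊗[ℂ] Ext A) = X
  induction X with
  | zero => simp
  | add x y hx hy => simp only [map_add, mul_add, add_mul, Finset.sum_add_distrib, hx, hy]
  | tmul b c =>
    simp only [Algebra.TensorProduct.map_tmul, LinearMap.lTensor_tmul,
      Algebra.TensorProduct.tmul_mul_tmul, momentum_mul_rotation, one_mul, mul_one,
      TensorProduct.tmul_sum]

/-- The coproduct of `V*(R') ⋊ Ã`. -/
def poincareComul (d : IsPoincareData R R' 𝓡 lam t) :
    Poincare R' 𝓡 lam t →ₐ[ℂ] Poincare R' 𝓡 lam t ⊗[ℂ] Poincare R' 𝓡 lam t :=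
  poincareLift (rotationComul R' 𝓡 lam t)
    (fun i => ∑ a, momentum R' 𝓡 lam t (gen R' a) ⊗ₜ[ℂ] rotation R' 𝓡 lam t (rotMat t a i) +
      1 ⊗ₜ[ℂ] momentum R' 𝓡 lam t (gen R' i))
    (d.isCovector_transform isCovector_momentum)
    (fun i a => by
      simp only [add_mul, mul_add, Finset.sum_add_distrib, d.rotated_momentum_mul, translation_mul])

lemma poincareComul_momentum (d : IsPoincareData R R' 𝓡 lam t) (i : Fin n) :
    d.poincareComul (momentum R' 𝓡 lam t (gen R' i)) =
      ∑ a, momentum R' 𝓡 lam t (gen R' a) ⊗ₜ[ℂ] rotation R' 𝓡 lam t (rotMat t a i) +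
        1 ⊗ₜ[ℂ] momentum R' 𝓡 lam t (gen R' i) := by
  rw [poincareComul, poincareLift_momentum]

lemma poincareComul_rotation (d : IsPoincareData R R' 𝓡 lam t) (a : Ext A) :
    d.poincareComul (rotation R' 𝓡 lam t a) =
      Algebra.TensorProduct.map (rotation R' 𝓡 lam t) (rotation R' 𝓡 lam t) (comul a) := by
  rw [poincareComul, poincareLift_rotation]
  rfl

lemma isCovector_zero (R' : Mat₂ n) (B : Type*) [Semiring B] [Algebra ℂ B] :
    IsCovector R' (fun _ => (0 : B)) := by
  rw [isCovector_iff]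
  simp

/-- The extension by zero on momenta of an algebra map out of `Ã`. -/
def extendByZero (R' : Mat₂ n) (𝓡 : A →ₗ[ℂ] A →ₗ[ℂ] ℂ) (lam : ℂ) (t : Matrix (Fin n) (Fin n) A)
    {B : Type*} [Semiring B] [Algebra ℂ B] (f : Ext A →ₐ[ℂ] B) : Poincare R' 𝓡 lam t →ₐ[ℂ] B :=
  poincareLift f (fun _ => 0) (isCovector_zero R' B) (by simp)

@[simp]
lemma extendByZero_rotation {B : Type*} [Semiring B] [Algebra ℂ B] (f : Ext A →ₐ[ℂ] B)
    (a : Ext A) : extendByZero R' 𝓡 lam t f (rotation R' 𝓡 lam t a) = f a := by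
  rw [extendByZero, poincareLift_rotation]

@[simp]
lemma extendByZero_momentum {B : Type*} [Semiring B] [Algebra ℂ B] (f : Ext A →ₐ[ℂ] B)
    (i : Fin n) : extendByZero R' 𝓡 lam t f (momentum R' 𝓡 lam t (gen R' i)) = 0 := by
  rw [extendByZero, poincareLift_momentum]

/-- The counit of `V*(R') ⋊ Ã`. -/
def poincareCounit (R' : Mat₂ n) (𝓡 : A →ₗ[ℂ] A →ₗ[ℂ] ℂ) (lam : ℂ) (t : Matrix (Fin n) (Fin n) A) :
    Poincare R' 𝓡 lam t →ₐ[ℂ] ℂ :=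
  extendByZero R' 𝓡 lam t (Bialgebra.counitAlgHom ℂ (Ext A))

lemma poincareCounit_rotation (a : Ext A) :
    poincareCounit R' 𝓡 lam t (rotation R' 𝓡 lam t a) = counit (R := ℂ) a := by
  rw [poincareCounit, extendByZero_rotation]
  rfl

lemma poincareCounit_momentum (i : Fin n) :
    poincareCounit R' 𝓡 lam t (momentum R' 𝓡 lam t (gen R' i)) = 0 :=
  extendByZero_momentum _ _

lemma poincareCounit_rotMat (d : IsPoincareData R R' 𝓡 lam t) (i j : Fin n) :
    poincareCounit R' 𝓡 lam t (rotation R' 𝓡 lam t (rotMat t i j)) = if i = j then 1 else 0 := by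
  rw [poincareCounit_rotation, d.coalgebra.counit_rotMat]

lemma poincareComul_rotMat (d : IsPoincareData R R' 𝓡 lam t) (i j : Fin n) :
    d.poincareComul (rotation R' 𝓡 lam t (rotMat t i j)) =
      ∑ a, rotation R' 𝓡 lam t (rotMat t i a) ⊗ₜ[ℂ] rotation R' 𝓡 lam t (rotMat t a j) := by
  rw [poincareComul_rotation, d.coalgebra.comul_rotMat]
  simp

/-! ### The antipode -/

/-- The antipode of `Ã` with values in `V*(R') ⋊ Ã`. -/
def rotationAntipode (R' : Mat₂ n) (𝓡 : A →ₗ[ℂ] A →ₗ[ℂ] ℂ) (lam : ℂ)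
    (t : Matrix (Fin n) (Fin n) A) : Ext A →ₗ[ℂ] Poincare R' 𝓡 lam t :=
  (rotation R' 𝓡 lam t).toLinearMap ∘ₗ HopfAlgebra.antipode ℂ

lemma rotationAntipode_mul (a b : Ext A) : rotationAntipode R' 𝓡 lam t (a * b) =
    rotationAntipode R' 𝓡 lam t b * rotationAntipode R' 𝓡 lam t a := by
  simp only [rotationAntipode, LinearMap.comp_apply, HopfAlgebra.antipode_mul_antidistrib,
    AlgHom.toLinearMap_apply, map_mul]

lemma rotationAntipode_one : rotationAntipode R' 𝓡 lam t 1 = 1 := by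
  simp only [rotationAntipode, LinearMap.comp_apply, HopfAlgebra.antipode_one,
    AlgHom.toLinearMap_apply, map_one]

lemma conv_rotationAntipode_rotation (a : Ext A) :
    conv (rotationAntipode R' 𝓡 lam t) (rotation R' 𝓡 lam t).toLinearMap a =
      counit (R := ℂ) a • 1 := by
  have h := congrArg (rotation R' 𝓡 lam t)
    (HopfAlgebra.mul_antipode_rTensor_comul_apply (R := ℂ) a)
  rw [AlgHom.commutes, Algebra.algebraMap_eq_smul_one] at h
  rw [← h, conv, LinearMap.comp_apply, LinearMap.comp_apply]
  generalize (comul a : Ext A ⊗[ℂ] Ext A) = X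
  induction X with
  | zero => simp
  | add x y hx hy => simp only [map_add, hx, hy]
  | tmul x y =>
    rw [TensorProduct.map_tmul, LinearMap.rTensor_tmul, LinearMap.mul'_apply, LinearMap.mul'_apply,
      map_mul]
    rfl

lemma conv_rotation_rotationAntipode (a : Ext A) :
    conv (rotation R' 𝓡 lam t).toLinearMap (rotationAntipode R' 𝓡 lam t) a =
      counit (R := ℂ) a • 1 := by
  have h := congrArg (rotation R' 𝓡 lam t)
    (HopfAlgebra.mul_antipode_lTensor_comul_apply (R := ℂ) a)
  rw [AlgHom.commutes, Algebra.algebraMap_eq_smul_one] at h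
  rw [← h, conv, LinearMap.comp_apply, LinearMap.comp_apply]
  generalize (comul a : Ext A ⊗[ℂ] Ext A) = X
  induction X with
  | zero => simp
  | add x y hx hy => simp only [map_add, hx, hy]
  | tmul x y =>
    rw [TensorProduct.map_tmul, LinearMap.lTensor_tmul, LinearMap.mul'_apply, LinearMap.mul'_apply,
      map_mul]
    rfl

/-- `S(a) p_j = p_k 𝓡(t^k_j g ⊗ a₍₁₎) S(a₍₂₎)`. -/
lemma rotationAntipode_mul_momentum (j : Fin n) (a : Ext A) :
    rotationAntipode R' 𝓡 lam t a * momentum R' 𝓡 lam t (gen R' j) =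
      ∑ k, momentum R' 𝓡 lam t (gen R' k) *
        rotationAntipode R' 𝓡 lam t (leftContract (extForm 𝓡 lam (rotMat t k j)) a) := by
  set rot := (rotation R' 𝓡 lam t).toLinearMap
  set s := rotationAntipode R' 𝓡 lam t
  set p := fun i => momentum R' 𝓡 lam t (gen R' i)
  -- The product `S(a₍₁₎) p_j a₍₂₎ S(a₍₃₎)` is computed in two ways. Moving `p_j` past `a₍₂₎` makes
  -- the first three factors collapse to `𝓡(t^k_j g ⊗ a) p_k`; the last three collapse to `ε(a) p_j`
  -- directly.
  have h1 : conv s (LinearMap.mulLeft ℂ (p j) ∘ₗ rot) =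
      ∑ k, (extForm 𝓡 lam (rotMat t k j)).smulRight (p k) := by
    have h2 : LinearMap.mulLeft ℂ (p j) ∘ₗ rot =
        ∑ k, LinearMap.mulRight ℂ (p k) ∘ₗ rot ∘ₗ crossCoeff 𝓡 lam t k j := by
      refine LinearMap.ext fun a => ?_
      rw [LinearMap.sum_apply]
      exact momentum_mul_rotation j a
    have h3 : ∀ k, conv s (LinearMap.mulRight ℂ (p k) ∘ₗ rot ∘ₗ crossCoeff 𝓡 lam t k j) =
        LinearMap.mulRight ℂ (p k) ∘ₗ conv s (rot ∘ₗ crossCoeff 𝓡 lam t k j) := by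
      intro k
      refine LinearMap.ext fun a => ?_
      simp only [conv, LinearMap.comp_apply]
      generalize (comul a : Ext A ⊗[ℂ] Ext A) = X
      induction X with
      | zero => simp
      | add x y hx hy => simp only [map_add, hx, hy]
      | tmul x y => simp [mul_assoc]
    rw [h2]
    have h4 : conv s (∑ k, LinearMap.mulRight ℂ (p k) ∘ₗ rot ∘ₗ crossCoeff 𝓡 lam t k j) =
        ∑ k, conv s (LinearMap.mulRight ℂ (p k) ∘ₗ rot ∘ₗ crossCoeff 𝓡 lam t k j) := by
      refine LinearMap.ext fun a => ?_
      rw [LinearMap.sum_apply]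
      simp only [conv, LinearMap.comp_apply]
      generalize (comul a : Ext A ⊗[ℂ] Ext A) = X
      induction X with
      | zero => simp
      | add x y hx hy => simp only [map_add, hx, hy, Finset.sum_add_distrib]
      | tmul x y => simp [Finset.mul_sum]
    rw [h4]
    refine Finset.sum_congr rfl fun k _ => ?_
    rw [h3]
    refine LinearMap.ext fun a => ?_
    rw [LinearMap.comp_apply, crossCoeff_eq, ← conv_comp_rightContract,
      conv_rotationAntipode_rotation, counit_rightContract]
    simp
  have h2 : conv (LinearMap.mulLeft ℂ (p j) ∘ₗ rot) s = (counit (R := ℂ)).smulRight (p j) := by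
    refine LinearMap.ext fun a => ?_
    have : conv (LinearMap.mulLeft ℂ (p j) ∘ₗ rot) s a = p j * conv rot s a := by
      simp only [conv, LinearMap.comp_apply]
      generalize (comul a : Ext A ⊗[ℂ] Ext A) = X
      induction X with
      | zero => simp
      | add x y hx hy => simp only [map_add, hx, hy, mul_add]
      | tmul x y => simp [mul_assoc]
    rw [this, conv_rotation_rotationAntipode]
    simp
  have h3 := LinearMap.congr_fun (conv_assoc s (LinearMap.mulLeft ℂ (p j) ∘ₗ rot) s) a
  rw [h1, h2] at h3
  have h4 : conv s ((counit (R := ℂ)).smulRight (p j)) a = s a * p j := by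
    have h := lTensor_counit_comul (R := ℂ) a
    have : ∀ X : Ext A ⊗[ℂ] Ext A, LinearMap.mul' ℂ _ (TensorProduct.map s
        ((counit (R := ℂ)).smulRight (p j)) X) =
        s (TensorProduct.rid ℂ _ (counit.lTensor (Ext A) X)) * p j := by
      intro X
      induction X using TensorProduct.induction_on with
      | zero => simp
      | add x y hx hy => simp only [map_add, hx, hy, add_mul]
      | tmul x y => simp
    rw [conv, LinearMap.comp_apply, LinearMap.comp_apply, this, h]
    simp
  have h5 : conv (∑ k, (extForm 𝓡 lam (rotMat t k j)).smulRight (p k)) s a =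
      ∑ k, p k * s (leftContract (extForm 𝓡 lam (rotMat t k j)) a) := by
    simp only [conv, leftContract, LinearMap.comp_apply]
    generalize (comul a : Ext A ⊗[ℂ] Ext A) = X
    induction X with
    | zero => simp
    | add x y hx hy => simp only [map_add, hx, hy, mul_add, Finset.sum_add_distrib]
    | tmul x y => simp [Finset.sum_mul]
  rw [← h4, ← h3, h5]

/-- The antipode on the generators: `S(𝐩) = -𝐩 S(𝐭 g)`. -/
def momentumAntipode (R' : Mat₂ n) (𝓡 : A →ₗ[ℂ] A →ₗ[ℂ] ℂ) (lam : ℂ)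
    (t : Matrix (Fin n) (Fin n) A) (i : Fin n) : Poincare R' 𝓡 lam t :=
  (-1 : ℂ) • ∑ j, momentum R' 𝓡 lam t (gen R' j) * rotationAntipode R' 𝓡 lam t (rotMat t j i)

/-- Moving `S(a)` past the momentum leaves a left contraction; `S` then merges it with `S(𝐭 g)` in
reversed order, so quasicommutativity applies inside `S`. The result is the cross relation in the
opposite algebra. -/
lemma rotationAntipode_mul_momentumAntipode (d : IsPoincareData R R' 𝓡 lam t) (i : Fin n)
    (a : Ext A) :
    rotationAntipode R' 𝓡 lam t a * momentumAntipode R' 𝓡 lam t i =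
      ∑ j, momentumAntipode R' 𝓡 lam t j *
        rotationAntipode R' 𝓡 lam t (crossCoeff 𝓡 lam t j i a) := by
  simp only [momentumAntipode, mul_smul_comm, smul_mul_assoc, ← Finset.smul_sum]
  congr 1
  simp only [Finset.mul_sum, Finset.sum_mul, ← mul_assoc, rotationAntipode_mul_momentum]
  simp only [mul_assoc, ← rotationAntipode_mul]
  rw [Finset.sum_comm]
  conv_rhs => rw [Finset.sum_comm]
  simp only [← Finset.mul_sum, ← map_sum, d.sum_rotMat_mul_leftContract]

lemma leftContract_rotMat (d : IsPoincareData R R' 𝓡 lam t) (i m k l : Fin n) :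
    leftContract (extForm 𝓡 lam (rotMat t i m)) (rotMat t k l) =
      ∑ a, R (i, k) (m, a) • rotMat t a l := by
  rw [leftContract, LinearMap.comp_apply, LinearMap.comp_apply, d.coalgebra.comul_rotMat]
  simp [d.extForm_rotMat]

/-- The signs cancel, and moving the inner momentum to the left through `S(𝐭 g)` costs one factor
`R`, because `𝓡` pairs the two copies of `𝐭 g` to `R`. -/
lemma momentumAntipode_mul (d : IsPoincareData R R' 𝓡 lam t) (j l : Fin n) :
    momentumAntipode R' 𝓡 lam t l * momentumAntipode R' 𝓡 lam t j =
      ∑ x, rowMul (fun x : Fin n × Fin n =>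
        momentum R' 𝓡 lam t (gen R' x.1) * momentum R' 𝓡 lam t (gen R' x.2)) (perm n * R) x *
          rotationAntipode R' 𝓡 lam t (tensorSq (rotMat t) x (j, l)) := by
  set p := fun i => momentum R' 𝓡 lam t (gen R' i)
  set s := rotationAntipode R' 𝓡 lam t
  have h : ∀ k m, p k * s (rotMat t k l) * (p m * s (rotMat t m j)) =
      ∑ i, ∑ a, R (i, k) (m, a) • (p k * p i * s (rotMat t m j * rotMat t a l)) := by
    intro k m
    rw [mul_assoc, ← mul_assoc (s _) (p m), rotationAntipode_mul_momentum, Finset.sum_mul,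
      Finset.mul_sum]
    refine Finset.sum_congr rfl fun i _ => ?_
    rw [d.leftContract_rotMat, map_sum, Finset.mul_sum, Finset.sum_mul, Finset.mul_sum]
    refine Finset.sum_congr rfl fun a _ => ?_
    simp only [map_smul, mul_smul_comm, smul_mul_assoc, rotationAntipode_mul, mul_assoc, s, p]
  have h' : momentumAntipode R' 𝓡 lam t l * momentumAntipode R' 𝓡 lam t j =
      ∑ k, ∑ m, p k * s (rotMat t k l) * (p m * s (rotMat t m j)) := by
    rw [momentumAntipode, momentumAntipode, smul_mul_smul_comm, neg_mul_neg, one_mul, one_smul]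
    simp only [Finset.sum_mul, Finset.mul_sum]
    exact Finset.sum_comm
  rw [h']
  simp only [h]
  rw [Finset.sum_comm, Fintype.sum_prod_type]
  refine Finset.sum_congr rfl fun m _ => ?_
  rw [Finset.sum_congr rfl fun k _ => Finset.sum_comm, Finset.sum_comm]
  refine Finset.sum_congr rfl fun a _ => ?_
  rw [← sum_eq_rowMul R (fun x : Fin n × Fin n => p x.1 * p x.2), Finset.sum_comm]
  simp only [Finset.sum_mul, smul_mul_assoc, tensorSq]

/-- In the opposite algebra the products form the row `N · PR` paired with `S(𝐭₁ 𝐭₂ g²)`. Since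
`PR'` commutes with `𝐭₁ 𝐭₂`, it is enough that `PR'` fixes `N · PR`. -/
lemma isCovector_momentumAntipode (d : IsPoincareData R R' 𝓡 lam t) :
    IsCovector R' (fun i => MulOpposite.op (momentumAntipode R' 𝓡 lam t i)) := by
  set N := fun x : Fin n × Fin n =>
    momentum R' 𝓡 lam t (gen R' x.1) * momentum R' 𝓡 lam t (gen R' x.2) with hN
  have hN1 : rowMul N (perm n * R') = N := isCovector_momentum
  -- Applying `(PR + 1) PR' = PR + 1` to `N` and cancelling `N · PR' = N` leaves the claim.
  have hN2 : rowMul (rowMul N (perm n * R)) (perm n * R') = rowMul N (perm n * R) := by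
    have h := d.hecke
    rw [mul_sub, mul_one, sub_eq_zero, add_mul, one_mul] at h
    have h2 := congrArg (rowMul N) h
    rw [rowMul_add, rowMul_add, rowMul_mul, hN1, rowMul_one] at h2
    exact add_right_cancel h2
  let φ : Poincare R' 𝓡 lam t →ₗ[ℂ] Ext A →ₗ[ℂ] (Poincare R' 𝓡 lam t)ᵐᵒᵖ :=
    (LinearMap.mul ℂ (Poincare R' 𝓡 lam t)).compl₁₂ LinearMap.id (rotationAntipode R' 𝓡 lam t)
      |>.compr₂ (MulOpposite.opLinearEquiv ℂ).toLinearMap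
  have h := rowMul_sum_bilin φ (rowMul N (perm n * R)) (tensorSq (rotMat t)) (perm n * R')
    d.commutesTensorSq_rotMat
  rw [hN2] at h
  have e : (fun x : Fin n × Fin n => MulOpposite.op (momentumAntipode R' 𝓡 lam t x.1) *
      MulOpposite.op (momentumAntipode R' 𝓡 lam t x.2)) =
      fun w => ∑ x, φ (rowMul N (perm n * R) x) (tensorSq (rotMat t) x w) := by
    ext1 ⟨j, l⟩
    rw [← MulOpposite.op_mul, d.momentumAntipode_mul, Finset.op_sum]
    rfl
  rw [IsCovector, e, h]

/-- The antipode of `Ã` as an algebra map to the opposite of `V*(R') ⋊ Ã`. -/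
def rotationAntipodeOp (R' : Mat₂ n) (𝓡 : A →ₗ[ℂ] A →ₗ[ℂ] ℂ) (lam : ℂ)
    (t : Matrix (Fin n) (Fin n) A) : Ext A →ₐ[ℂ] (Poincare R' 𝓡 lam t)ᵐᵒᵖ :=
  AlgHom.ofLinearMap ((MulOpposite.opLinearEquiv ℂ).toLinearMap ∘ₗ rotationAntipode R' 𝓡 lam t)
    (by
      rw [LinearMap.comp_apply, rotationAntipode_one]
      rfl)
    (fun a b => by
      rw [LinearMap.comp_apply, rotationAntipode_mul]
      rfl)

lemma rotationAntipodeOp_apply (a : Ext A) : rotationAntipodeOp R' 𝓡 lam t a =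
    MulOpposite.op (rotationAntipode R' 𝓡 lam t a) := rfl

/-- The antipode of `V*(R') ⋊ Ã` as an algebra map to the opposite algebra. -/
def poincareAntipodeOp (d : IsPoincareData R R' 𝓡 lam t) :
    Poincare R' 𝓡 lam t →ₐ[ℂ] (Poincare R' 𝓡 lam t)ᵐᵒᵖ :=
  poincareLift (rotationAntipodeOp R' 𝓡 lam t)
    (fun i => MulOpposite.op (momentumAntipode R' 𝓡 lam t i)) d.isCovector_momentumAntipode
    (fun i a => by
      simp only [rotationAntipodeOp_apply, ← MulOpposite.op_mul, ← Finset.op_sum,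
        d.rotationAntipode_mul_momentumAntipode i a])

/-- The antipode of `V*(R') ⋊ Ã`. -/
def poincareAntipode (d : IsPoincareData R R' 𝓡 lam t) :
    Poincare R' 𝓡 lam t →ₗ[ℂ] Poincare R' 𝓡 lam t :=
  (MulOpposite.opLinearEquiv ℂ).symm.toLinearMap ∘ₗ d.poincareAntipodeOp.toLinearMap

lemma poincareAntipode_rotation (d : IsPoincareData R R' 𝓡 lam t) (a : Ext A) :
    d.poincareAntipode (rotation R' 𝓡 lam t a) =
      rotation R' 𝓡 lam t (HopfAlgebra.antipode ℂ a) := by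
  rw [poincareAntipode, LinearMap.comp_apply, AlgHom.toLinearMap_apply, poincareAntipodeOp,
    poincareLift_rotation]
  rfl

lemma poincareAntipode_momentum (d : IsPoincareData R R' 𝓡 lam t) (i : Fin n) :
    d.poincareAntipode (momentum R' 𝓡 lam t (gen R' i)) =
      (-1 : ℂ) • ∑ j, momentum R' 𝓡 lam t (gen R' j) * d.poincareAntipode (rotation R' 𝓡 lam t
        (rotMat t j i)) := by
  simp only [poincareAntipode_rotation]
  rw [poincareAntipode, LinearMap.comp_apply, AlgHom.toLinearMap_apply, poincareAntipodeOp,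
    poincareLift_momentum]
  rfl

lemma poincareAntipode_mul (d : IsPoincareData R R' 𝓡 lam t) (x y : Poincare R' 𝓡 lam t) :
    d.poincareAntipode (x * y) = d.poincareAntipode y * d.poincareAntipode x := by
  simp only [poincareAntipode, LinearMap.comp_apply, AlgHom.toLinearMap_apply, map_mul]
  rfl

lemma poincareAntipode_one (d : IsPoincareData R R' 𝓡 lam t) : d.poincareAntipode 1 = 1 := by
  simp only [poincareAntipode, LinearMap.comp_apply, AlgHom.toLinearMap_apply, map_one]
  rfl

end IsPoincareData

end QPoincare

end

noncomputable section

namespace QPoincare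

open Coalgebra

/-! ### The Hopf algebra axioms -/

variable {A : Type*} [Ring A] [HopfAlgebra ℂ A] {n : ℕ}

/-- Two-sided convolution identities for an antimultiplicative map only have to be checked on
generators: they are closed under products. -/
lemma antipode_left_mul {B : Type*} [Ring B] [Algebra ℂ B] (S : B →ₗ[ℂ] B)
    (hS : ∀ x y, S (x * y) = S y * S x) {c e : ℂ} {X Y : B ⊗[ℂ] B}
    (hX : LinearMap.mul' ℂ B (S.rTensor B X) = c • 1)
    (hY : LinearMap.mul' ℂ B (S.rTensor B Y) = e • 1) :
    LinearMap.mul' ℂ B (S.rTensor B (X * Y)) = (c * e) • 1 := by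
  have h : LinearMap.mul' ℂ B (S.rTensor B (X * Y)) = c • LinearMap.mul' ℂ B (S.rTensor B Y) := by
    clear hY
    induction Y with
    | zero => simp
    | add x y hx hy => simp only [map_add, mul_add, hx, hy, smul_add]
    | tmul u v =>
      have h1 : LinearMap.mul' ℂ B (S.rTensor B (X * u ⊗ₜ[ℂ] v)) =
          S u * LinearMap.mul' ℂ B (S.rTensor B X) * v := by
        clear hX
        induction X with
        | zero => simp
        | add x y hx hy => simp only [map_add, add_mul, mul_add, hx, hy]
        | tmul x y => simp [hS, mul_assoc]
      rw [h1, hX]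
      simp
  rw [h, hY, smul_smul]

lemma antipode_right_mul {B : Type*} [Ring B] [Algebra ℂ B] (S : B →ₗ[ℂ] B)
    (hS : ∀ x y, S (x * y) = S y * S x) {c e : ℂ} {X Y : B ⊗[ℂ] B}
    (hX : LinearMap.mul' ℂ B (S.lTensor B X) = c • 1)
    (hY : LinearMap.mul' ℂ B (S.lTensor B Y) = e • 1) :
    LinearMap.mul' ℂ B (S.lTensor B (X * Y)) = (c * e) • 1 := by
  have h : LinearMap.mul' ℂ B (S.lTensor B (X * Y)) = e • LinearMap.mul' ℂ B (S.lTensor B X) := by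
    clear hX
    induction X with
    | zero => simp
    | add x y hx hy => simp only [map_add, add_mul, hx, hy, smul_add]
    | tmul u v =>
      have h1 : LinearMap.mul' ℂ B (S.lTensor B (u ⊗ₜ[ℂ] v * Y)) =
          u * LinearMap.mul' ℂ B (S.lTensor B Y) * S v := by
        clear hY
        induction Y with
        | zero => simp
        | add x y hx hy => simp only [map_add, add_mul, mul_add, hx, hy]
        | tmul x y => simp [hS, mul_assoc]
      rw [h1, hY]
      simp
  rw [h, hX, smul_smul, mul_comm]

namespace IsPoincareData

variable {R R' : Mat₂ n} {𝓡 : A →ₗ[ℂ] A →ₗ[ℂ] ℂ} {lam : ℂ} {t : Matrix (Fin n) (Fin n) A}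

lemma map_comul_rotation {B C : Type*} [Semiring B] [Algebra ℂ B] [Semiring C] [Algebra ℂ C]
    (f : Poincare R' 𝓡 lam t →ₐ[ℂ] B) (g : Poincare R' 𝓡 lam t →ₐ[ℂ] C)
    (d : IsPoincareData R R' 𝓡 lam t) (a : Ext A) :
    Algebra.TensorProduct.map f g (d.poincareComul (rotation R' 𝓡 lam t a)) =
      TensorProduct.map (f.comp (rotation R' 𝓡 lam t)).toLinearMap
        (g.comp (rotation R' 𝓡 lam t)).toLinearMap (comul a) := by
  rw [poincareComul_rotation]
  generalize (comul a : Ext A ⊗[ℂ] Ext A) = X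
  induction X with
  | zero => simp
  | add x y hx hy => simp only [map_add, hx, hy]
  | tmul x y => simp

/-- Both iterated coproducts send `𝐩` to `𝐩 ⊗ 𝐭 g ⊗ 𝐭 g + 1 ⊗ 𝐩 ⊗ 𝐭 g + 1 ⊗ 1 ⊗ 𝐩`; on `Ã` the
identity is the image of coassociativity there. -/
lemma poincareComul_coassoc (d : IsPoincareData R R' 𝓡 lam t) :
    (Algebra.TensorProduct.assoc ℂ ℂ ℂ _ _ _).toAlgHom.comp
      ((Algebra.TensorProduct.map d.poincareComul (AlgHom.id ℂ _)).comp d.poincareComul) =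
    (Algebra.TensorProduct.map (AlgHom.id ℂ _) d.poincareComul).comp d.poincareComul := by
  refine poincare_algHom_ext (fun i => ?_) (fun a => ?_)
  · simp only [AlgHom.comp_apply, poincareComul_momentum, map_add, map_sum,
      Algebra.TensorProduct.map_tmul, AlgHom.id_apply, map_one, poincareComul_rotMat,
      TensorProduct.add_tmul, TensorProduct.tmul_add, TensorProduct.sum_tmul,
      TensorProduct.tmul_sum, Finset.sum_add_distrib, Algebra.TensorProduct.one_def]
    rw [Finset.sum_comm, add_assoc]
    rfl
  · set rot := (rotation R' 𝓡 lam t).toLinearMap with hrot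
    have h := congrArg (TensorProduct.map rot (TensorProduct.map rot rot))
      (coassoc_apply (R := ℂ) a)
    have e : ∀ b, d.poincareComul (rotation R' 𝓡 lam t b) =
        TensorProduct.map rot rot (comul b) := fun b => d.poincareComul_rotation b
    simp only [AlgHom.comp_apply, map_comul_rotation]
    refine Eq.trans ?_ (h.trans ?_)
    · generalize (comul a : Ext A ⊗[ℂ] Ext A) = X
      induction X with
      | zero => simp
      | add x y hx hy => simp only [map_add, hx, hy]
      | tmul x y =>
        rw [TensorProduct.map_tmul, LinearMap.rTensor_tmul, AlgHom.toLinearMap_apply,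
          AlgHom.comp_apply, e]
        generalize (comul x : Ext A ⊗[ℂ] Ext A) = X
        induction X with
        | zero => simp
        | add x y hx hy => simp only [map_add, TensorProduct.add_tmul, hx, hy]
        | tmul x y => rfl
    · generalize (comul a : Ext A ⊗[ℂ] Ext A) = X
      induction X with
      | zero => simp
      | add x y hx hy => simp only [map_add, hx, hy]
      | tmul x y =>
        rw [TensorProduct.map_tmul, LinearMap.lTensor_tmul, AlgHom.toLinearMap_apply,
          AlgHom.toLinearMap_apply, AlgHom.comp_apply, AlgHom.comp_apply, e]
        rfl

lemma poincare_counit_left (d : IsPoincareData R R' 𝓡 lam t) :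
    (Algebra.TensorProduct.lid ℂ _).toAlgHom.comp
      ((Algebra.TensorProduct.map (poincareCounit R' 𝓡 lam t) (AlgHom.id ℂ _)).comp
        d.poincareComul) = AlgHom.id ℂ _ := by
  refine poincare_algHom_ext (fun i => ?_) (fun a => ?_)
  · simp [poincareComul_momentum, poincareCounit_momentum]
  · have h := congrArg (rotation R' 𝓡 lam t ∘ TensorProduct.lid ℂ (Ext A))
      (rTensor_counit_comul (R := ℂ) a)
    simp only [AlgHom.comp_apply, map_comul_rotation]
    refine Eq.trans ?_ (h.trans (by simp))
    generalize (comul a : Ext A ⊗[ℂ] Ext A) = X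
    induction X with
    | zero => simp
    | add x y hx hy => simp only [map_add, hx, hy, Function.comp_apply] at hx hy ⊢
    | tmul x y => simp [poincareCounit_rotation]

lemma poincare_counit_right (d : IsPoincareData R R' 𝓡 lam t) :
    (Algebra.TensorProduct.rid ℂ ℂ _).toAlgHom.comp
      ((Algebra.TensorProduct.map (AlgHom.id ℂ _) (poincareCounit R' 𝓡 lam t)).comp
        d.poincareComul) = AlgHom.id ℂ _ := by
  refine poincare_algHom_ext (fun i => ?_) (fun a => ?_)
  · simp [poincareComul_momentum, poincareCounit_momentum]
    simp only [d.poincareCounit_rotMat, ite_smul, one_smul, zero_smul, Finset.sum_ite_eq',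
      Finset.mem_univ, if_true]
  · have h := congrArg (rotation R' 𝓡 lam t ∘ TensorProduct.rid ℂ (Ext A))
      (lTensor_counit_comul (R := ℂ) a)
    simp only [AlgHom.comp_apply, map_comul_rotation]
    refine Eq.trans ?_ (h.trans (by simp))
    generalize (comul a : Ext A ⊗[ℂ] Ext A) = X
    induction X with
    | zero => simp
    | add x y hx hy => simp only [map_add, hx, hy, Function.comp_apply] at hx hy ⊢
    | tmul x y => simp [poincareCounit_rotation]

lemma conv_eq_mul_rTensor (d : IsPoincareData R R' 𝓡 lam t) (a : Ext A) :
    LinearMap.mul' ℂ _ (d.poincareAntipode.rTensor _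
      (d.poincareComul (rotation R' 𝓡 lam t a))) = counit (R := ℂ) a • 1 := by
  rw [← conv_rotationAntipode_rotation (R' := R') (𝓡 := 𝓡) (lam := lam) (t := t),
    poincareComul_rotation, conv, LinearMap.comp_apply, LinearMap.comp_apply]
  generalize (comul a : Ext A ⊗[ℂ] Ext A) = X
  induction X with
  | zero => simp
  | add x y hx hy => simp only [map_add, hx, hy]
  | tmul x y => simp [poincareAntipode_rotation, rotationAntipode]

lemma conv_eq_mul_lTensor (d : IsPoincareData R R' 𝓡 lam t) (a : Ext A) :
    LinearMap.mul' ℂ _ (d.poincareAntipode.lTensor _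
      (d.poincareComul (rotation R' 𝓡 lam t a))) = counit (R := ℂ) a • 1 := by
  rw [← conv_rotation_rotationAntipode (R' := R') (𝓡 := 𝓡) (lam := lam) (t := t),
    poincareComul_rotation, conv, LinearMap.comp_apply, LinearMap.comp_apply]
  generalize (comul a : Ext A ⊗[ℂ] Ext A) = X
  induction X with
  | zero => simp
  | add x y hx hy => simp only [map_add, hx, hy]
  | tmul x y => simp [poincareAntipode_rotation, rotationAntipode]

lemma poincare_antipode_left (d : IsPoincareData R R' 𝓡 lam t) (h : Poincare R' 𝓡 lam t) :
    LinearMap.mul' ℂ _ (d.poincareAntipode.rTensor _ (d.poincareComul h)) =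
      poincareCounit R' 𝓡 lam t h • 1 := by
  induction h using poincare_induction with
  | hp i =>
    rw [poincareComul_momentum, poincareCounit_momentum]
    simp only [map_add, map_sum, LinearMap.rTensor_tmul, LinearMap.mul'_apply,
      poincareAntipode_one, poincareAntipode_momentum, one_mul, zero_smul, smul_mul_assoc,
      Finset.sum_mul, ← Finset.smul_sum, mul_assoc]
    rw [Finset.sum_comm]
    -- By the antipode axiom for `𝐭 g`, `S(p_j) t^j_i g = -p_k S(t^k_j g) t^j_i g = -p_i`, which
    -- cancels the term `S(1) p_i`.
    have h1 : ∀ k, ∑ j, d.poincareAntipode (rotation R' 𝓡 lam t (rotMat t k j)) *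
        rotation R' 𝓡 lam t (rotMat t j i) = (if k = i then 1 else 0 : ℂ) • 1 := by
      intro k
      rw [← d.coalgebra.counit_rotMat, ← d.conv_eq_mul_rTensor, poincareComul_rotMat]
      simp
    simp only [← Finset.mul_sum, h1]
    simp
  | hr a => rw [conv_eq_mul_rTensor, poincareCounit_rotation]
  | hadd v w hv hw => simp only [map_add, hv, hw, add_smul]
  | hmul v w hv hw =>
    rw [map_mul d.poincareComul, map_mul (poincareCounit R' 𝓡 lam t)]
    exact antipode_left_mul _ d.poincareAntipode_mul hv hw

lemma poincare_antipode_right (d : IsPoincareData R R' 𝓡 lam t) (h : Poincare R' 𝓡 lam t) :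
    LinearMap.mul' ℂ _ (d.poincareAntipode.lTensor _ (d.poincareComul h)) =
      poincareCounit R' 𝓡 lam t h • 1 := by
  induction h using poincare_induction with
  | hp i =>
    rw [poincareComul_momentum, poincareCounit_momentum]
    simp only [map_add, map_sum, LinearMap.lTensor_tmul, LinearMap.mul'_apply,
      poincareAntipode_momentum, one_mul, zero_smul]
    -- Here no antipode axiom is needed: `𝐩 S(𝐭 g)` and `S(𝐩)` are opposite by the choice of `S(𝐩)`.
    generalize (∑ x, momentum R' 𝓡 lam t (gen R' x) *
      d.poincareAntipode (rotation R' 𝓡 lam t (rotMat t x i))) = w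
    module
  | hr a => rw [conv_eq_mul_lTensor, poincareCounit_rotation]
  | hadd v w hv hw => simp only [map_add, hv, hw, add_smul]
  | hmul v w hv hw =>
    rw [map_mul d.poincareComul, map_mul (poincareCounit R' 𝓡 lam t)]
    exact antipode_right_mul _ d.poincareAntipode_mul hv hw

lemma isHopf (d : IsPoincareData R R' 𝓡 lam t) :
    IsHopf d.poincareComul (poincareCounit R' 𝓡 lam t) d.poincareAntipode where
  coassoc := by
    rw [rTensor_toLinearMap, lTensor_toLinearMap, assoc_toLinearMap]
    exact congrArg AlgHom.toLinearMap d.poincareComul_coassoc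
  counit_left := by
    rw [rTensor_toLinearMap, lid_toLinearMap]
    exact congrArg AlgHom.toLinearMap d.poincare_counit_left
  counit_right := by
    rw [lTensor_toLinearMap, rid_toLinearMap]
    exact congrArg AlgHom.toLinearMap d.poincare_counit_right
  antipode_left := LinearMap.ext fun h => by
    simpa [Algebra.algebraMap_eq_smul_one] using d.poincare_antipode_left h
  antipode_right := LinearMap.ext fun h => by
    simpa [Algebra.algebraMap_eq_smul_one] using d.poincare_antipode_right h

lemma isSemidirectHopf (d : IsPoincareData R R' 𝓡 lam t) :
    IsSemidirectHopf R R' 𝓡 lam t d.poincareComul (poincareCounit R' 𝓡 lam t)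
      d.poincareAntipode where
  bijective := d.normalOrder_bijective
  cross_dil i := by
    rw [momentum_mul_rotation]
    simp only [d.crossCoeff_dil, map_smul, smul_mul_assoc]
    simp only [ite_smul, zero_smul, Finset.sum_ite_eq', Finset.mem_univ, if_true]
  cross_matrix i k l := by
    rw [momentum_mul_rotation]
    simp only [d.crossCoeff_toExt, map_sum, map_smul, Finset.sum_mul, smul_mul_assoc]
  hopf := d.isHopf
  comul_momentum := d.poincareComul_momentum
  comul_rotation := d.poincareComul_rotation
  counit_momentum := poincareCounit_momentum
  counit_rotation := poincareCounit_rotation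
  antipode_rotation := d.poincareAntipode_rotation

end IsPoincareData

end QPoincare

end

noncomputable section

namespace QPoincare

open Coalgebra

/-! ### Tensor product coactions -/

section TensorCoaction

variable {V W H K : Type*} [AddCommGroup V] [Module ℂ V] [AddCommGroup W] [Module ℂ W]
  [Ring H] [Algebra ℂ H] [Ring K] [Algebra ℂ K]

/-- The tensor product coaction multiplies coefficients, so an algebra map may be applied before or
after. With `𝐩 ↦ 0` it transfers covariance to `Ã`. -/
lemma lTensor_tensorCoaction (f : H →ₐ[ℂ] K) (ρ : V →ₗ[ℂ] V ⊗[ℂ] H) (σ : W →ₗ[ℂ] W ⊗[ℂ] H)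
    (z : V ⊗[ℂ] W) :
    f.toLinearMap.lTensor (V ⊗[ℂ] W) (tensorCoaction ρ σ z) =
      tensorCoaction (f.toLinearMap.lTensor V ∘ₗ ρ) (f.toLinearMap.lTensor W ∘ₗ σ) z := by
  induction z with
  | zero => simp
  | add x y hx hy => simp only [map_add, hx, hy]
  | tmul v w =>
    simp only [tensorCoaction, LinearMap.comp_apply, TensorProduct.map_tmul]
    generalize ρ v = X
    generalize σ w = Y
    induction X with
    | zero => simp
    | add x y hx hy => simp only [map_add, TensorProduct.add_tmul, hx, hy]
    | tmul a b =>
    induction Y with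
    | zero => simp
    | add x y hx hy => simp only [map_add, TensorProduct.tmul_add, hx, hy]
    | tmul c d => simp

/-- When `e` is itself a product of two algebra maps, composing it with a tensor product coaction
multiplies the two coactions in one algebra. This is the case for the braided embedding. -/
lemma rTensor_mul_tensorTensorTensorComm {A B C : Type*} [Semiring A] [Algebra ℂ A]
    [Semiring B] [Algebra ℂ B] [Semiring C] [Algebra ℂ C] {f : A →ₐ[ℂ] C} {g : B →ₐ[ℂ] C} {e : A ⊗[ℂ] B →ₗ[ℂ] C}
    (he : ∀ a b, e (a ⊗ₜ b) = f a * g b) (X : A ⊗[ℂ] H) (Y : B ⊗[ℂ] H) :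
    e.rTensor H ((LinearMap.mul' ℂ H).lTensor (A ⊗[ℂ] B)
        (TensorProduct.tensorTensorTensorComm ℂ A H B H (X ⊗ₜ Y))) =
      Algebra.TensorProduct.map f (AlgHom.id ℂ H) X *
        Algebra.TensorProduct.map g (AlgHom.id ℂ H) Y := by
  induction X with
  | zero => simp
  | add x y hx hy => simp only [map_add, TensorProduct.add_tmul, add_mul, hx, hy]
  | tmul v h =>
  induction Y with
  | zero => simp
  | add x y hx hy => simp only [map_add, TensorProduct.tmul_add, mul_add, hx, hy]
  | tmul w k => simp [he]

end TensorCoaction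

variable {A : Type*} [Ring A] [HopfAlgebra ℂ A] {n : ℕ}

namespace IsPoincareData

variable {R R' : Mat₂ n} {𝓡 : A →ₗ[ℂ] A →ₗ[ℂ] ℂ} {lam : ℂ} {t : Matrix (Fin n) (Fin n) A}

/-! ### The coactions -/

lemma isRightCoaction_rotationCoaction (d : IsPoincareData R R' 𝓡 lam t) :
    IsRightCoaction comul counit d.rotationCoaction.toLinearMap where
  coassoc := by
    have h : (Algebra.TensorProduct.assoc ℂ ℂ ℂ (Covector R') (Ext A) (Ext A)).toAlgHom.comp
        ((Algebra.TensorProduct.map d.rotationCoaction (AlgHom.id ℂ _)).comp d.rotationCoaction) =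
        (Algebra.TensorProduct.map (AlgHom.id ℂ _) (Bialgebra.comulAlgHom ℂ (Ext A))).comp
          d.rotationCoaction := by
      refine covector_algHom_ext fun i => ?_
      simp only [AlgHom.comp_apply, rotationCoaction_gen, map_sum, Algebra.TensorProduct.map_tmul,
        AlgHom.id_apply, Bialgebra.comulAlgHom_apply, d.coalgebra.comul_rotMat,
        TensorProduct.sum_tmul, TensorProduct.tmul_sum]
      exact Finset.sum_comm
    exact LinearMap.ext fun v => AlgHom.congr_fun h v
  counit := by
    have h : (Algebra.TensorProduct.rid ℂ ℂ (Covector R')).toAlgHom.comp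
        ((Algebra.TensorProduct.map (AlgHom.id ℂ _) (Bialgebra.counitAlgHom ℂ (Ext A))).comp
          d.rotationCoaction) = AlgHom.id ℂ _ := by
      refine covector_algHom_ext fun i => ?_
      simp only [AlgHom.comp_apply, rotationCoaction_gen, map_sum, Algebra.TensorProduct.map_tmul,
        AlgHom.id_apply, Bialgebra.counitAlgHom_apply, d.coalgebra.counit_rotMat]
      refine (Finset.sum_congr rfl fun a _ => Algebra.TensorProduct.rid_tmul ℂ _ _).trans ?_
      simp only [ite_smul, one_smul, zero_smul, Finset.sum_ite_eq', Finset.mem_univ, if_true]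
    exact LinearMap.ext fun v => AlgHom.congr_fun h v

/-- The coaction of `Ã` on the braided covectors with values in `V*(R') ⋊ Ã`. -/
def poincareRotation (d : IsPoincareData R R' 𝓡 lam t) :
    Covector R' →ₐ[ℂ] Covector R' ⊗[ℂ] Poincare R' 𝓡 lam t :=
  (Algebra.TensorProduct.map (AlgHom.id ℂ _) (rotation R' 𝓡 lam t)).comp d.rotationCoaction

lemma poincareRotation_gen (d : IsPoincareData R R' 𝓡 lam t) (i : Fin n) :
    d.poincareRotation (gen R' i) = ∑ a, gen R' a ⊗ₜ rotation R' 𝓡 lam t (rotMat t a i) := by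
  simp [poincareRotation, rotationCoaction_gen]

/-- The coaction of `V*(R') ⋊ Ã` on the braided covectors. -/
def poincareCoaction (d : IsPoincareData R R' 𝓡 lam t) :
    Covector R' →ₐ[ℂ] Covector R' ⊗[ℂ] Poincare R' 𝓡 lam t :=
  covectorLift (fun i => ∑ a, gen R' a ⊗ₜ[ℂ] rotation R' 𝓡 lam t (rotMat t a i) +
      1 ⊗ₜ[ℂ] momentum R' 𝓡 lam t (gen R' i)) (d.isCovector_transform (isCovector_gen R'))

lemma poincareCoaction_gen (d : IsPoincareData R R' 𝓡 lam t) (i : Fin n) :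
    d.poincareCoaction (gen R' i) = ∑ a, gen R' a ⊗ₜ[ℂ] rotation R' 𝓡 lam t (rotMat t a i) +
      1 ⊗ₜ[ℂ] momentum R' 𝓡 lam t (gen R' i) :=
  covectorLift_gen _ _ i

lemma isRightCoaction_poincareCoaction (d : IsPoincareData R R' 𝓡 lam t) :
    IsRightCoaction d.poincareComul.toLinearMap (poincareCounit R' 𝓡 lam t).toLinearMap
      d.poincareCoaction.toLinearMap where
  coassoc := by
    have h : (Algebra.TensorProduct.assoc ℂ ℂ ℂ (Covector R') _ _).toAlgHom.comp
        ((Algebra.TensorProduct.map d.poincareCoaction (AlgHom.id ℂ _)).comp d.poincareCoaction) =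
        (Algebra.TensorProduct.map (AlgHom.id ℂ _) d.poincareComul).comp d.poincareCoaction := by
      refine covector_algHom_ext fun i => ?_
      simp only [AlgHom.comp_apply, poincareCoaction_gen, map_add, map_sum,
        Algebra.TensorProduct.map_tmul, AlgHom.id_apply, map_one, poincareComul_rotMat,
        poincareComul_momentum, TensorProduct.add_tmul, TensorProduct.tmul_add,
        TensorProduct.sum_tmul, TensorProduct.tmul_sum, Finset.sum_add_distrib,
        Algebra.TensorProduct.one_def]
      rw [Finset.sum_comm, add_assoc]
      rfl
    exact LinearMap.ext fun v => AlgHom.congr_fun h v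
  counit := by
    have h : (Algebra.TensorProduct.rid ℂ ℂ (Covector R')).toAlgHom.comp
        ((Algebra.TensorProduct.map (AlgHom.id ℂ _) (poincareCounit R' 𝓡 lam t)).comp
          d.poincareCoaction) = AlgHom.id ℂ _ := by
      refine covector_algHom_ext fun i => ?_
      simp only [AlgHom.comp_apply, poincareCoaction_gen, map_add, map_sum,
        Algebra.TensorProduct.map_tmul, AlgHom.id_apply, d.poincareCounit_rotMat,
        poincareCounit_momentum]
      rw [TensorProduct.tmul_zero, map_zero, add_zero]
      refine (Finset.sum_congr rfl fun a _ => Algebra.TensorProduct.rid_tmul ℂ _ _).trans ?_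
      simp only [ite_smul, one_smul, zero_smul, Finset.sum_ite_eq', Finset.mem_univ, if_true]
    exact LinearMap.ext fun v => AlgHom.congr_fun h v

/-- The coaction `β` is the coproduct restricted to momenta, with its first leg read back in
`V*(R')`. -/
lemma poincareComul_comp_momentum (d : IsPoincareData R R' 𝓡 lam t) (v : Covector R') :
    d.poincareComul (momentum R' 𝓡 lam t v) =
      Algebra.TensorProduct.map (momentum R' 𝓡 lam t) (AlgHom.id ℂ _) (d.poincareCoaction v) := by
  have : d.poincareComul.comp (momentum R' 𝓡 lam t) =
      (Algebra.TensorProduct.map (momentum R' 𝓡 lam t) (AlgHom.id ℂ _)).comp d.poincareCoaction :=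
    covector_algHom_ext fun i => by
      simp [poincareComul_momentum, poincareCoaction_gen]
  exact AlgHom.congr_fun this v

/-! ### The braided coproduct -/

/-- The map `a ⊗ b ↦ a⁽¹⁾ ⊗ a⁽²⁾ b`, which embeds the braided tensor square of the braided covectors
in the ordinary tensor product `V*(R') ⊗ (V*(R') ⋊ Ã)`. -/
def braidedEmbedding (d : IsPoincareData R R' 𝓡 lam t) :
    Covector R' ⊗[ℂ] Covector R' →ₗ[ℂ] Covector R' ⊗[ℂ] Poincare R' 𝓡 lam t :=
  LinearMap.mul' ℂ _ ∘ₗ TensorProduct.map d.poincareRotation.toLinearMap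
    (Algebra.TensorProduct.includeRight.comp (momentum R' 𝓡 lam t)).toLinearMap

lemma braidedEmbedding_tmul (d : IsPoincareData R R' 𝓡 lam t) (a b : Covector R') :
    d.braidedEmbedding (a ⊗ₜ b) = d.poincareRotation a * (1 ⊗ₜ momentum R' 𝓡 lam t b) := rfl

/-- The left inverse of the embedding of the braided tensor square. -/
def braidedProjection (d : IsPoincareData R R' 𝓡 lam t) :
    Covector R' ⊗[ℂ] Poincare R' 𝓡 lam t →ₗ[ℂ] Covector R' ⊗[ℂ] Covector R' :=
  ((TensorProduct.lid ℂ (Covector R')).toLinearMap ∘ₗ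
    (counit (R := ℂ) (A := Ext A)).rTensor (Covector R') ∘ₗ d.denormalOrder).lTensor (Covector R')

/-- Undoing normal ordering separates `a⁽²⁾` from `b`; the counit then removes `a⁽²⁾` by the
coaction axiom. -/
lemma braidedProjection_braidedEmbedding (d : IsPoincareData R R' 𝓡 lam t)
    (z : Covector R' ⊗[ℂ] Covector R') : d.braidedProjection (d.braidedEmbedding z) = z := by
  induction z with
  | zero => simp
  | add x y hx hy => simp only [map_add, hx, hy]
  | tmul a b =>
    have h : ∀ X : Covector R' ⊗[ℂ] Ext A, d.braidedProjection
        (Algebra.TensorProduct.map (AlgHom.id ℂ _) (rotation R' 𝓡 lam t) X *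
          (1 ⊗ₜ momentum R' 𝓡 lam t b)) =
        (TensorProduct.rid ℂ _ (counit.lTensor _ X)) ⊗ₜ b := by
      intro X
      induction X with
      | zero => simp
      | add x y hx hy => simp only [map_add, add_mul, TensorProduct.add_tmul, hx, hy]
      | tmul v h =>
        rw [Algebra.TensorProduct.map_tmul, Algebra.TensorProduct.tmul_mul_tmul, mul_one,
          ← normalOrder_tmul, braidedProjection, LinearMap.lTensor_tmul, LinearMap.comp_apply,
          LinearMap.comp_apply, denormalOrder_normalOrder]
        simp [TensorProduct.smul_tmul]
    have hc := LinearMap.congr_fun d.isRightCoaction_rotationCoaction.counit a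
    refine (h (d.rotationCoaction a)).trans ?_
    exact congrArg (· ⊗ₜ[ℂ] b) hc

/-- The endomorphism `h ⊗ w ↦ h₍₁₎ ⊗ v w 𝓡(k ⊗ h₍₂₎)` of `Ã ⊗ V*(R')` attached to `v ⊗ k`. -/
def coefficientAction (d : IsPoincareData R R' 𝓡 lam t) :
    Covector R' ⊗[ℂ] Ext A →ₐ[ℂ] Module.End ℂ (Ext A ⊗[ℂ] Covector R') :=
  Module.endTensorEndAlgHom.comp <|
    (Algebra.TensorProduct.map (contractHom d.isCoquasitriangular)
      (Algebra.lmul ℂ (Covector R'))).comp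
    (Algebra.TensorProduct.comm ℂ (Covector R') (Ext A)).toAlgHom

lemma coefficientAction_tmul (d : IsPoincareData R R' 𝓡 lam t) (v w : Covector R') (k h : Ext A) :
    d.coefficientAction (v ⊗ₜ k) (h ⊗ₜ w) =
      rightContract (extForm 𝓡 lam k) h ⊗ₜ (v * w) := rfl

/-- Replacing the coaction of `b` by an arbitrary tensor keeps the action linear in it, so that
`braidedEmbedding_braiding` can be proved on pure tensors. -/
lemma coefficientAction_rotationCoaction (d : IsPoincareData R R' 𝓡 lam t) (b : Covector R') :
    d.coefficientAction (d.rotationCoaction b) = d.covectorAction b := rfl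

lemma momentum_mul_poincareRotation (d : IsPoincareData R R' 𝓡 lam t) (b c : Covector R') :
    (1 ⊗ₜ momentum R' 𝓡 lam t b) * d.poincareRotation c =
      (normalOrder R' 𝓡 lam t ∘ₗ d.coefficientAction (d.rotationCoaction b) ∘ₗ
        (TensorProduct.mk ℂ (Ext A) (Covector R')).flip 1).lTensor _ (d.rotationCoaction c) := by
  rw [coefficientAction_rotationCoaction, poincareRotation, AlgHom.comp_apply]
  generalize d.rotationCoaction c = Y
  induction Y with
  | zero => simp
  | add x y hx hy => simp only [map_add, mul_add, hx, hy]
  | tmul w h =>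
    rw [Algebra.TensorProduct.map_tmul, Algebra.TensorProduct.tmul_mul_tmul, one_mul,
      LinearMap.lTensor_tmul, LinearMap.comp_apply, LinearMap.comp_apply, LinearMap.flip_apply,
      TensorProduct.mk_apply, normalOrder_covectorAction, normalOrder_tmul, map_one, mul_one]
    rfl

/-- The braiding is exactly what reordering produces: `b c⁽²⁾ = c⁽²⁾₍₁₎ b⁽¹⁾ 𝓡(b⁽²⁾ ⊗ c⁽²⁾₍₂₎)`, and
coassociativity of the coaction on `c` identifies the two ways of splitting its coefficient. -/
lemma braidedEmbedding_braiding (d : IsPoincareData R R' 𝓡 lam t) (b c : Covector R') :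
    d.braidedEmbedding (braiding (extForm 𝓡 lam) d.rotationCoaction.toLinearMap (b ⊗ₜ c)) =
      (1 ⊗ₜ momentum R' 𝓡 lam t b) * d.poincareRotation c := by
  rw [momentum_mul_poincareRotation, braiding]
  simp only [LinearMap.comp_apply, TensorProduct.map_tmul, AlgHom.toLinearMap_apply]
  generalize d.rotationCoaction b = X
  induction X with
  | zero => simp
  | add x y hx hy =>
    simp only [map_add, TensorProduct.add_tmul, LinearMap.add_comp, LinearMap.comp_add,
      LinearMap.lTensor_add, LinearMap.add_apply, hx, hy]
  | tmul v k =>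
    -- `J` is `w ⊗ x ⊗ y ↦ 𝓡(k ⊗ y) w ⊗ x v`. Both sides are `J` of an iterated coaction: `h1` with
    -- the coaction applied twice, `h3` with the coproduct on the coefficient.
    let J : Covector R' ⊗[ℂ] Ext A ⊗[ℂ] Ext A →ₗ[ℂ] Covector R' ⊗[ℂ] Poincare R' 𝓡 lam t :=
      LinearMap.mulRight ℂ (1 ⊗ₜ momentum R' 𝓡 lam t v) ∘ₗ
        ((rotation R' 𝓡 lam t).toLinearMap.lTensor (Covector R')) ∘ₗ
        (TensorProduct.rid ℂ _).toLinearMap ∘ₗ (extForm 𝓡 lam k).lTensor _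
    have h1 : ∀ Y : Covector R' ⊗[ℂ] Ext A, d.braidedEmbedding (TensorProduct.rid ℂ _
        (TensorProduct.map (TensorProduct.comm ℂ _ _).toLinearMap
          (TensorProduct.lift (extForm 𝓡 lam))
          (TensorProduct.tensorTensorTensorComm ℂ _ _ _ _ ((v ⊗ₜ k) ⊗ₜ Y)))) =
        J (d.rotationCoaction.toLinearMap.rTensor _ Y) := by
      intro Y
      induction Y with
      | zero => simp
      | add x y hx hy => simp only [map_add, TensorProduct.tmul_add, hx, hy]
      | tmul w h =>
        simp only [TensorProduct.tensorTensorTensorComm_tmul, TensorProduct.map_tmul,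
          LinearEquiv.coe_coe, TensorProduct.comm_tmul, TensorProduct.lift.tmul,
          TensorProduct.rid_tmul, map_smul, braidedEmbedding_tmul, LinearMap.rTensor_tmul,
          LinearMap.comp_apply, LinearMap.lTensor_tmul, LinearMap.mulRight_apply, J,
          lTensor_toLinearMap]
        rfl
    have h2 : ∀ (w : Covector R') (Z : Ext A ⊗[ℂ] Ext A),
        J ((TensorProduct.assoc ℂ _ _ _).symm (w ⊗ₜ Z)) = w ⊗ₜ (rotation R' 𝓡 lam t
          (TensorProduct.rid ℂ _ ((extForm 𝓡 lam k).lTensor _ Z)) * momentum R' 𝓡 lam t v) := by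
      intro w Z
      induction Z using TensorProduct.induction_on with
      | zero => simp
      | add x y hx hy => simp only [map_add, TensorProduct.tmul_add, add_mul, hx, hy]
      | tmul x y => simp [J]
    have h3 : ∀ Y : Covector R' ⊗[ℂ] Ext A,
        J ((TensorProduct.assoc ℂ _ _ _).symm (comul.lTensor _ Y)) =
        (normalOrder R' 𝓡 lam t ∘ₗ d.coefficientAction (v ⊗ₜ k) ∘ₗ
          (TensorProduct.mk ℂ (Ext A) (Covector R')).flip 1).lTensor _ Y := by
      intro Y
      induction Y with
      | zero => simp
      | add x y hx hy => simp only [map_add, hx, hy]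
      | tmul w h =>
        rw [LinearMap.lTensor_tmul, h2, LinearMap.lTensor_tmul, LinearMap.comp_apply,
          LinearMap.comp_apply, LinearMap.flip_apply, TensorProduct.mk_apply,
          coefficientAction_tmul, normalOrder_tmul, mul_one]
        rfl
    have h4 := LinearMap.congr_fun d.isRightCoaction_rotationCoaction.coassoc c
    rw [LinearMap.comp_apply, LinearMap.comp_apply, LinearMap.comp_apply, LinearEquiv.coe_coe,
      ← LinearEquiv.eq_symm_apply] at h4
    refine (h1 (d.rotationCoaction c)).trans ?_
    rw [← h3]
    exact congrArg J h4

/-- The outer factors `a` and `e` multiply as in the ordinary algebra, so only the exchange of `b`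
and `c` matters, and that is `braidedEmbedding_braiding`. -/
lemma braidedEmbedding_braidedMul (d : IsPoincareData R R' 𝓡 lam t)
    (x y : Covector R' ⊗[ℂ] Covector R') :
    d.braidedEmbedding (braidedMul (braiding (extForm 𝓡 lam) d.rotationCoaction.toLinearMap)
      (x ⊗ₜ y)) = d.braidedEmbedding x * d.braidedEmbedding y := by
  induction x with
  | zero => simp
  | add x y hx hy => simp only [map_add, TensorProduct.add_tmul, add_mul, hx, hy]
  | tmul a b =>
  induction y with
  | zero => simp
  | add x y hx hy => simp only [map_add, TensorProduct.tmul_add, mul_add, hx, hy]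
  | tmul c e =>
    have h : ∀ Z : Covector R' ⊗[ℂ] Covector R', d.braidedEmbedding
        (TensorProduct.map (LinearMap.mul' ℂ (Covector R')) (LinearMap.mul' ℂ (Covector R'))
          ((TensorProduct.tensorTensorTensorAssoc ℂ _ _ _ _).symm ((a ⊗ₜ Z) ⊗ₜ e))) =
        d.poincareRotation a * d.braidedEmbedding Z * (1 ⊗ₜ momentum R' 𝓡 lam t e) := by
      intro Z
      induction Z with
      | zero => simp
      | add x y hx hy =>
        simp only [map_add, TensorProduct.tmul_add, TensorProduct.add_tmul, mul_add, add_mul, hx,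
          hy]
      | tmul u v =>
        simp only [TensorProduct.tensorTensorTensorAssoc_symm_tmul, TensorProduct.map_tmul,
          LinearMap.mul'_apply, braidedEmbedding_tmul, map_mul, mul_assoc,
          Algebra.TensorProduct.tmul_mul_tmul, one_mul]
    refine (h (braiding (extForm 𝓡 lam) d.rotationCoaction.toLinearMap (b ⊗ₜ c))).trans ?_
    rw [braidedEmbedding_braiding, braidedEmbedding_tmul, braidedEmbedding_tmul]
    simp only [mul_assoc]

/-- The linear braided coproduct. -/
def braidedCoproduct (d : IsPoincareData R R' 𝓡 lam t) :
    Covector R' →ₗ[ℂ] Covector R' ⊗[ℂ] Covector R' :=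
  d.braidedProjection ∘ₗ d.poincareCoaction.toLinearMap

lemma braidedEmbedding_one_tmul_one (d : IsPoincareData R R' 𝓡 lam t) :
    d.braidedEmbedding (1 ⊗ₜ 1) = 1 := by
  rw [braidedEmbedding_tmul, map_one, map_one, one_mul, Algebra.TensorProduct.one_def]

lemma braidedEmbedding_primitive (d : IsPoincareData R R' 𝓡 lam t) (i : Fin n) :
    d.braidedEmbedding (gen R' i ⊗ₜ 1 + 1 ⊗ₜ gen R' i) = d.poincareCoaction (gen R' i) := by
  rw [map_add, braidedEmbedding_tmul, braidedEmbedding_tmul, poincareCoaction_gen,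
    poincareRotation_gen, map_one, map_one, one_mul, ← Algebra.TensorProduct.one_def, mul_one]

/-- The image of the embedding contains `1` and every `β(x_i)`, and it is closed under products
because braided products map to products. -/
lemma exists_braidedEmbedding_eq (d : IsPoincareData R R' 𝓡 lam t) (v : Covector R') :
    ∃ z, d.braidedEmbedding z = d.poincareCoaction v := by
  induction v using covector_induction with
  | hgen i => exact ⟨_, d.braidedEmbedding_primitive i⟩
  | halg c =>
    refine ⟨c • (1 ⊗ₜ 1), ?_⟩
    rw [map_smul, braidedEmbedding_one_tmul_one, AlgHom.commutes, Algebra.algebraMap_eq_smul_one]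
  | hadd v w hv hw =>
    obtain ⟨x, hx⟩ := hv
    obtain ⟨y, hy⟩ := hw
    exact ⟨x + y, by rw [map_add, map_add, hx, hy]⟩
  | hmul v w hv hw =>
    obtain ⟨x, hx⟩ := hv
    obtain ⟨y, hy⟩ := hw
    exact ⟨braidedMul (braiding (extForm 𝓡 lam) d.rotationCoaction.toLinearMap) (x ⊗ₜ y), by
      rw [braidedEmbedding_braidedMul, hx, hy, map_mul d.poincareCoaction]⟩

lemma braidedEmbedding_braidedCoproduct (d : IsPoincareData R R' 𝓡 lam t) (v : Covector R') :
    d.braidedEmbedding (d.braidedCoproduct v) = d.poincareCoaction v := by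
  obtain ⟨z, hz⟩ := d.exists_braidedEmbedding_eq v
  rw [braidedCoproduct, LinearMap.comp_apply, AlgHom.toLinearMap_apply, ← hz,
    braidedProjection_braidedEmbedding]

lemma braidedEmbedding_injective (d : IsPoincareData R R' 𝓡 lam t) :
    Function.Injective d.braidedEmbedding :=
  Function.LeftInverse.injective d.braidedProjection_braidedEmbedding

lemma isLinearBraidedCoproduct (d : IsPoincareData R R' 𝓡 lam t) :
    IsLinearBraidedCoproduct (braiding (extForm 𝓡 lam) d.rotationCoaction.toLinearMap)
      d.braidedCoproduct where
  map_gen i := d.braidedEmbedding_injective <| by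
    rw [braidedEmbedding_braidedCoproduct, braidedEmbedding_primitive]
  map_one := d.braidedEmbedding_injective <| by
    rw [braidedEmbedding_braidedCoproduct, map_one, braidedEmbedding_one_tmul_one]
  map_mul v w := d.braidedEmbedding_injective <| by
    rw [braidedEmbedding_braidedCoproduct, map_mul, braidedEmbedding_braidedMul,
      braidedEmbedding_braidedCoproduct, braidedEmbedding_braidedCoproduct]

lemma braiding_gen (d : IsPoincareData R R' 𝓡 lam t) (j l : Fin n) :
    braiding (extForm 𝓡 lam) d.rotationCoaction.toLinearMap (gen R' j ⊗ₜ gen R' l) =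
      ∑ i, ∑ k, R (i, k) (j, l) • (gen R' k ⊗ₜ[ℂ] gen R' i) := by
  simp only [braiding, LinearMap.comp_apply, TensorProduct.map_tmul, AlgHom.toLinearMap_apply,
    rotationCoaction_gen, TensorProduct.sum_tmul, TensorProduct.tmul_sum, map_sum]
  rw [Finset.sum_comm]
  refine Finset.sum_congr rfl fun i _ => Finset.sum_congr rfl fun k _ => ?_
  simp only [LinearEquiv.coe_coe, TensorProduct.tensorTensorTensorComm_tmul,
    TensorProduct.map_tmul, TensorProduct.comm_tmul, TensorProduct.lift.tmul,
    TensorProduct.rid_tmul, d.extForm_rotMat]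

/-! ### Covariance of the braided coproduct -/

/-- The map `v ⊗ h ↦ v ⊗ Δ h`, with its values bracketed to the left. -/
def comulRight (d : IsPoincareData R R' 𝓡 lam t) :
    Covector R' ⊗[ℂ] Poincare R' 𝓡 lam t →ₐ[ℂ]
      (Covector R' ⊗[ℂ] Poincare R' 𝓡 lam t) ⊗[ℂ] Poincare R' 𝓡 lam t :=
  (Algebra.TensorProduct.assoc ℂ ℂ ℂ _ _ _).symm.toAlgHom.comp
    (Algebra.TensorProduct.map (AlgHom.id ℂ _) d.poincareComul)

lemma comulRight_poincareRotation (d : IsPoincareData R R' 𝓡 lam t) (v : Covector R') :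
    d.comulRight (d.poincareRotation v) =
      Algebra.TensorProduct.map d.poincareRotation (AlgHom.id ℂ _) (d.poincareRotation v) := by
  have : d.comulRight.comp d.poincareRotation =
      (Algebra.TensorProduct.map d.poincareRotation (AlgHom.id ℂ _)).comp d.poincareRotation :=
    covector_algHom_ext fun i => by
      simp only [comulRight, AlgHom.comp_apply, poincareRotation_gen, map_sum,
        Algebra.TensorProduct.map_tmul, AlgHom.id_apply, poincareComul_rotMat,
        TensorProduct.tmul_sum, TensorProduct.sum_tmul]
      exact Finset.sum_comm
  exact AlgHom.congr_fun this v

lemma comulRight_poincareCoaction (d : IsPoincareData R R' 𝓡 lam t) (v : Covector R') :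
    d.comulRight (d.poincareCoaction v) =
      d.poincareCoaction.toLinearMap.rTensor _ (d.poincareCoaction v) := by
  have h := LinearMap.congr_fun d.isRightCoaction_poincareCoaction.coassoc v
  rw [LinearMap.comp_apply, LinearMap.comp_apply, LinearMap.comp_apply, LinearEquiv.coe_coe,
    lTensor_toLinearMap] at h
  refine (congrArg (TensorProduct.assoc ℂ _ _ _).symm h.symm).trans ?_
  rw [LinearEquiv.symm_apply_apply]
  rfl

/-- Both sides are products of a contribution of `a` and one of `b`: the first agree by
coassociativity of the rotation coaction, the second because `β` is the coproduct on momenta. -/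
lemma rTensor_braidedEmbedding_tensorCoaction (d : IsPoincareData R R' 𝓡 lam t)
    (z : Covector R' ⊗[ℂ] Covector R') :
    d.braidedEmbedding.rTensor _ (tensorCoaction d.poincareRotation.toLinearMap
      d.poincareCoaction.toLinearMap z) = d.comulRight (d.braidedEmbedding z) := by
  induction z with
  | zero => simp only [map_zero]
  | add x y hx hy => simp only [map_add, hx, hy]
  | tmul a b =>
    rw [braidedEmbedding_tmul, map_mul, comulRight_poincareRotation]
    have h1 : d.comulRight (1 ⊗ₜ momentum R' 𝓡 lam t b) =
        Algebra.TensorProduct.map (Algebra.TensorProduct.includeRight.comp (momentum R' 𝓡 lam t))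
          (AlgHom.id ℂ _) (d.poincareCoaction b) := by
      rw [comulRight, AlgHom.comp_apply, Algebra.TensorProduct.map_tmul,
        poincareComul_comp_momentum]
      generalize d.poincareCoaction b = Y
      induction Y with
      | zero => simp only [map_zero, TensorProduct.tmul_zero]
      | add x y hx hy => simp only [map_add, TensorProduct.tmul_add, hx, hy]
      | tmul x y => rfl
    rw [h1]
    exact rTensor_mul_tensorTensorTensorComm d.braidedEmbedding_tmul _ _

/-- After the injective embedding, the left side is `β` applied twice and the right side is the
coproduct on the coefficient of `β`; these agree by coassociativity. -/
lemma poincare_covariant (d : IsPoincareData R R' 𝓡 lam t) (v : Covector R') :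
    d.braidedCoproduct.rTensor _ (d.poincareCoaction v) =
      tensorCoaction d.poincareRotation.toLinearMap d.poincareCoaction.toLinearMap
        (d.braidedCoproduct v) := by
  -- The explicit left inverse survives tensoring, so no flatness is needed.
  have hinj : Function.Injective (d.braidedEmbedding.rTensor (Poincare R' 𝓡 lam t)) := by
    refine Function.LeftInverse.injective (g := d.braidedProjection.rTensor _) fun z => ?_
    rw [← LinearMap.comp_apply, ← LinearMap.rTensor_comp]
    have : d.braidedProjection ∘ₗ d.braidedEmbedding = LinearMap.id :=
      LinearMap.ext d.braidedProjection_braidedEmbedding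
    rw [this, LinearMap.rTensor_id, LinearMap.id_apply]
  apply hinj
  rw [rTensor_braidedEmbedding_tensorCoaction, braidedEmbedding_braidedCoproduct,
    comulRight_poincareCoaction, ← LinearMap.comp_apply, ← LinearMap.rTensor_comp]
  have : d.braidedEmbedding ∘ₗ d.braidedCoproduct = d.poincareCoaction.toLinearMap :=
    LinearMap.ext d.braidedEmbedding_braidedCoproduct
  rw [this]

lemma rotation_covariant (d : IsPoincareData R R' 𝓡 lam t) (v : Covector R') :
    d.braidedCoproduct.rTensor _ (d.rotationCoaction v) =
      tensorCoaction d.rotationCoaction.toLinearMap d.rotationCoaction.toLinearMap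
        (d.braidedCoproduct v) := by
  -- Setting `𝐩 = 0` retracts the semidirect product onto `Ã` and turns both coactions in
  -- `poincare_covariant` into the rotation coaction.
  set f := extendByZero R' 𝓡 lam t (AlgHom.id ℂ (Ext A)) with hf
  have h1 : f.toLinearMap.lTensor _ ∘ₗ d.poincareRotation.toLinearMap =
      d.rotationCoaction.toLinearMap := by
    rw [lTensor_toLinearMap]
    refine congrArg AlgHom.toLinearMap (?_ : (Algebra.TensorProduct.map (AlgHom.id ℂ _) f).comp
      d.poincareRotation = d.rotationCoaction)
    exact covector_algHom_ext fun i => by simp [poincareRotation_gen, rotationCoaction_gen, hf]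
  have h2 : f.toLinearMap.lTensor _ ∘ₗ d.poincareCoaction.toLinearMap =
      d.rotationCoaction.toLinearMap := by
    rw [lTensor_toLinearMap]
    refine congrArg AlgHom.toLinearMap (?_ : (Algebra.TensorProduct.map (AlgHom.id ℂ _) f).comp
      d.poincareCoaction = d.rotationCoaction)
    exact covector_algHom_ext fun i => by simp [poincareCoaction_gen, rotationCoaction_gen, hf]
  have h := congrArg (f.toLinearMap.lTensor _) (d.poincare_covariant v)
  rw [lTensor_tensorCoaction, h1, h2, ← LinearMap.comp_apply, LinearMap.lTensor_comp_rTensor,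
    ← LinearMap.rTensor_comp_lTensor, LinearMap.comp_apply] at h
  rw [← h]
  exact congrArg _ (LinearMap.congr_fun h2 v).symm

lemma poincareCovariance (d : IsPoincareData R R' 𝓡 lam t) : PoincareCovariance R R' 𝓡 lam t := by
  refine ⟨d.rotationCoaction, d.braidedCoproduct, d.poincareComul, poincareCounit R' 𝓡 lam t,
    d.poincareAntipode, d.poincareCoaction, ⟨d.rotationCoaction_gen,
      d.isRightCoaction_rotationCoaction⟩, d.braiding_gen, d.isLinearBraidedCoproduct,
    d.isSemidirectHopf, d.poincareCoaction_gen, d.isRightCoaction_poincareCoaction,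
    LinearMap.ext d.rotation_covariant, ?_⟩
  rw [lTensor_toLinearMap]
  exact LinearMap.ext d.poincare_covariant

end IsPoincareData

end QPoincare

end

noncomputable section

namespace QPoincare

variable {A : Type*} [Ring A] [HopfAlgebra ℂ A] {n : ℕ}

/-! ### `q`-Minkowski space -/

lemma commutesTensorSq_iff_commute (M : Mat₂ n) (t : Matrix (Fin n) (Fin n) A) :
    CommutesTensorSq M t ↔ Commute (M.map (algebraMap ℂ A)) (Matrix.of (tensorSq t)) := by
  rw [commute_iff_eq, ← Matrix.ext_iff]
  refine forall_congr' fun x => forall_congr' fun z => ?_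
  simp only [Matrix.mul_apply, Matrix.map_apply, Matrix.of_apply, Algebra.smul_def,
    Algebra.commutes]

/-- Quasicommutativity evaluated on two entries of `𝐭` is the relation `R₁₂ 𝐭₁ 𝐭₂ = 𝐭₂ 𝐭₁ R₁₂` up to
the factor `λ`, which is cancelled. -/
lemma IsDualQuasitriangular.commutesTensorSq {𝓡 : A →ₗ[ℂ] A →ₗ[ℂ] ℂ}
    (h : IsDualQuasitriangular 𝓡) {t : Matrix (Fin n) (Fin n) A} (ht : IsMatrixCoalgebra t)
    {lam : ℂ} (hlam : lam ≠ 0) {R : Mat₂ n}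
    (hRt : ∀ i j k l, 𝓡 (t i j) (t k l) = lam * R (i, k) (j, l)) :
    CommutesTensorSq (perm n * R) t := by
  rw [← matrixCommutes_iff]
  intro i j k l
  have e := h.sum_mul_leftContract ht i j (t k l)
  simp only [leftContract, rightContract, LinearMap.comp_apply, ht.comul, map_sum,
    LinearMap.rTensor_tmul, LinearMap.lTensor_tmul, LinearEquiv.coe_coe, TensorProduct.lid_tmul,
    TensorProduct.rid_tmul, hRt, Finset.mul_sum, Finset.sum_mul, mul_smul_comm, smul_mul_assoc,
    mul_smul, ← Finset.smul_sum] at e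
  exact smul_right_injective A hlam e

lemma perm_mul_minkowskiR' (R : Mat₂ n) (q μ : ℂ) : perm n * minkowskiR' R q μ =
    1 + μ • ((perm n * R - (q ^ 2)⁻¹ • 1) * (perm n * R - q ^ 2 • 1)) := by
  rw [minkowskiR', mul_add, perm_mul_perm, mul_smul_comm, mul_assoc (perm n), ← mul_assoc (perm n),
    perm_mul_perm, one_mul]

/-- `PR'` is a polynomial in `PR`, and the scalar matrices commuting with `𝐭₁ 𝐭₂` form an algebra.
-/
lemma CommutesTensorSq.minkowskiR' {R : Mat₂ n} {t : Matrix (Fin n) (Fin n) A}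
    (h : CommutesTensorSq (perm n * R) t) (q μ : ℂ) :
    CommutesTensorSq (perm n * minkowskiR' R q μ) t := by
  rw [commutesTensorSq_iff_commute] at h ⊢
  let f : Mat₂ n →ₐ[ℂ] Matrix (Fin n × Fin n) (Fin n × Fin n) A := (Algebra.ofId ℂ A).mapMatrix
  change Commute (f _) _ at h
  change Commute (f _) _
  rw [perm_mul_minkowskiR', map_add, map_one, map_smul, map_mul, map_sub, map_sub, map_smul,
    map_smul, map_one]
  exact (Commute.one_left _).add_left (((h.sub_left ((Commute.one_left _).smul_left _)).mul_left
    (h.sub_left ((Commute.one_left _).smul_left _))).smul_left μ)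

end QPoincare

end

open QPoincare in
theorem corollary8 {n : ℕ} {A : Type*} [Ring A] [HopfAlgebra ℂ A]
    (R : Mat₂ n) (hR : IsUnit R) (hqybe : IsQYBE R)
    (𝓡 : A →ₗ[ℂ] A →ₗ[ℂ] ℂ) (h𝓡 : IsDualQuasitriangular 𝓡)
    (t : Matrix (Fin n) (Fin n) A) (ht : IsMatrixCoalgebra t)
    (lam : ℂ) (hlam : lam ≠ 0)
    (hRt : ∀ i j k l, 𝓡 (t i j) (t k l) = lam * R (i, k) (j, l)) :
    -- general braided covectors, with `R'₁₂ 𝐭₁ 𝐭₂ = 𝐭₂ 𝐭₁ R'₁₂` in `A`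
    (∀ R' : Mat₂ n, IsUnit R' → IsBraidedCovectorData R R' → MatrixCommutes R' t →
      PoincareCovariance R R' 𝓡 lam t) ∧
    -- `q`-Minkowski space
    (∀ q μ : ℂ, q ≠ 0 →
      (perm n * R + 1) * (perm n * R - (q ^ 2)⁻¹ • 1) * (perm n * R - q ^ 2 • 1) = 0 →
      IsUnit (minkowskiR' R q μ) →
      PoincareCovariance R (minkowskiR' R q μ) 𝓡 lam t) := by
  refine ⟨fun R' _ h hc => IsPoincareData.poincareCovariance ⟨h𝓡, ht, hlam, hRt, h.hecke, hc⟩,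
    fun q μ _ hq _ => IsPoincareData.poincareCovariance ⟨h𝓡, ht, hlam, hRt, ?_, ?_⟩⟩
  -- Here `PR' - 1 = μ (PR - q⁻²)(PR - q²)`, so the product with `PR + 1` is `μ` times the cubic in
  -- `hq`.
  · rw [perm_mul_minkowskiR', add_sub_cancel_left, mul_smul_comm, ← mul_assoc, hq, smul_zero]
  · rw [matrixCommutes_iff]
    exact (h𝓡.commutesTensorSq ht hlam hRt).minkowskiR' q μ
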